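/- Let $\mathbb R^2_+=\{x_2>0\}$, $s=\{(x_1,0):|x_1|\ge 1\}$ and $\Gamma_1=[-1,1]\times\{0\}$, and let $\nu=(0,-1)$ be the outer unit normal on $\partial\mathbb R^2_+$. Let $\mathcal Q$ be the completion of $C^\infty_c(\overline{\mathbb R^2_+}\setminus s)$ under the norm $\big(\int_{\mathbb R^2_+}|\nabla u|^2\,dx\big)^{1/2}$, realized as a space of functions on $\mathbb R^2_+$ (limits in $L^2$ on bounded subsets). For a positive integer $k$ let $\psi_k(r\cos t,r\sin t)=r^k\sin(kt)$, i.e. $\psi_k(x)=\operatorname{Im}(x_1+ix_2)^k$. For every positive integer $k$ the problem $$-\Delta w_k=0\ \text{ in }\mathbb R^2_+,\qquad w_k=0\ \text{ on }s,\qquad \frac{\partial w_k}{\partial\nu}=-\frac{\partial\psi_k}{\partial\nu}\ \text{ on }\Gamma_1$$ has a unique weak solution $w_k\in\mathcal Q$, that is, $$\int_{\mathbb R^2_+}\nabla w_k\cdot\nabla\varphi\,dx=-\int_{-1}^1\frac{\partial\psi_k}{\partial\nu}(x_1,0)\,\varphi(x_1,0)\,dx_1\quad\text{for all }\varphi\in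 C^\infty_c(\overline{\mathbb R^2_+}\setminus s);$$ it has a representative that is $C^1$ on $\mathbb R^2_+\cup\big((-1,1)\times\{0\}\big)$, and for any such representative the integral below converges and $$\int_{-1}^{1}\frac{\partial w_k}{\partial x_2}(x_1,0)\,w_k(x_1,0)\,dx_1=-\frac{k\pi}{2^{2k-1}}\binom{k-1}{\lfloor (k-1)/2\rfloor}^{2}.$$ -/

import Mathlib

open MeasureTheory Filter Topology Set
open scoped ContDiff

namespace MixedProblem

/-- The open upper half-plane `{x₂ > 0}` of the plane `ℝ × ℝ`. -/
def upperHalf : Set (ℝ × ℝ) := {x | 0 < x.2}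

/-- The Dirichlet part `{x₂ = 0, x₁ ≥ 1 or x₁ ≤ -1}` of the boundary of the half-plane. -/
def dirichletPart : Set (ℝ × ℝ) := {x | x.2 = 0 ∧ (1 ≤ x.1 ∨ x.1 ≤ -1)}

/-- The (relatively open) Neumann part `(-1, 1) × {0}` of the boundary of the half-plane. -/
def neumannPart : Set (ℝ × ℝ) := {x | x.2 = 0 ∧ -1 < x.1 ∧ x.1 < 1}

/-- The first partial derivative `∂φ/∂x₁`. -/
noncomputable def partial₁ (φ : ℝ × ℝ → ℝ) (x : ℝ × ℝ) : ℝ := fderiv ℝ φ x (1, 0)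

/-- The second partial derivative `∂φ/∂x₂`. -/
noncomputable def partial₂ (φ : ℝ × ℝ → ℝ) (x : ℝ × ℝ) : ℝ := fderiv ℝ φ x (0, 1)

/-- The derivative at a point in the direction of the outer unit normal `ν = (0, -1)` of the
upper half-plane. -/
noncomputable def normalDeriv (φ : ℝ × ℝ → ℝ) (x : ℝ × ℝ) : ℝ := fderiv ℝ φ x (0, -1)

/-- The homogeneous harmonic polynomial `ψ_k = Im (x₁ + i x₂)^k`; in polar coordinates it is
`r ^ k * sin (k t)`, see `psi_polar`. -/
noncomputable def psi (k : ℕ) (x : ℝ × ℝ) : ℝ :=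
  (((x.1 : ℂ) + (x.2 : ℂ) * Complex.I) ^ k).im

theorem psi_polar (k : ℕ) (r t : ℝ) :
    psi k (r * Real.cos t, r * Real.sin t) = r ^ k * Real.sin (k * t) := by
  have h : (((r * Real.cos t : ℝ) : ℂ) + ((r * Real.sin t : ℝ) : ℂ) * Complex.I)
      = (r : ℂ) * (Complex.cos t + Complex.sin t * Complex.I) := by
    push_cast; ring
  have h2 : (((r : ℂ) ^ k * (Complex.cos (k * t) + Complex.sin (k * t) * Complex.I))).im
      = r ^ k * Real.sin (k * t) := by
    have e : ((r : ℂ) ^ k * (Complex.cos (k * t) + Complex.sin (k * t) * Complex.I))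
        = ((r ^ k * Real.cos (k * t) : ℝ) : ℂ)
          + ((r ^ k * Real.sin (k * t) : ℝ) : ℂ) * Complex.I := by
      push_cast; ring
    rw [e]; simp only [Complex.add_im, Complex.ofReal_im,
      Complex.im_ofReal_mul, Complex.I_im, mul_one, zero_add]
  unfold psi
  simp only
  rw [h, mul_pow, Complex.cos_add_sin_mul_I_pow, h2]

/-- The class `C_c^∞` of the closed half-plane with the Dirichlet part removed. Its members are
the restrictions to the half-plane of smooth compactly supported functions on the plane whose
support does not meet the Dirichlet part (it may meet the Neumann part). -/
structure IsTestFunction (φ : ℝ × ℝ → ℝ) : Prop where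
  smooth : ContDiff ℝ ∞ φ
  compact : HasCompactSupport φ
  disjoint : Disjoint (tsupport φ) dirichletPart

/-- `u` belongs to the completion of the test functions for the norm
`(∫ |∇φ|²)^(1/2)` over the upper half-plane, and `(g₁, g₂)` is its gradient.
An element of the completion is given by test functions `φ n` whose gradients converge in `L²`;
it is realized as the function `u` to which the `φ n` converge in `L²` on bounded subsets of the
half-plane (the gradient norm controls these `L²` norms on test functions, by Hardy's inequality).
Functions matter only up to null sets of the half-plane. -/
structure MemQ (u g₁ g₂ : ℝ × ℝ → ℝ) : Prop where
  measurable : AEStronglyMeasurable u (volume.restrict upperHalf)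
  measurable₁ : AEStronglyMeasurable g₁ (volume.restrict upperHalf)
  measurable₂ : AEStronglyMeasurable g₂ (volume.restrict upperHalf)
  approx : ∃ φ : ℕ → ℝ × ℝ → ℝ, (∀ n, IsTestFunction (φ n)) ∧
    Tendsto (fun n => eLpNorm (fun x => partial₁ (φ n) x - g₁ x) 2 (volume.restrict upperHalf))
      atTop (𝓝 0) ∧
    Tendsto (fun n => eLpNorm (fun x => partial₂ (φ n) x - g₂ x) 2 (volume.restrict upperHalf))
      atTop (𝓝 0) ∧
    ∀ R : ℝ, Tendsto (fun n => eLpNorm (fun x => φ n x - u x) 2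
      (volume.restrict (upperHalf ∩ Metric.ball 0 R))) atTop (𝓝 0)

/-- `w` is a weak solution, in the completion above, of the mixed problem
`-Δ w = 0` in the upper half-plane, `w = 0` on the Dirichlet part,
`∂w/∂ν = -∂ψ_k/∂ν` on the Neumann part. (The test functions are dense in the completion, so it is
the same to test with them or with all its elements.) -/
def IsWeakSolution (k : ℕ) (w : ℝ × ℝ → ℝ) : Prop :=
  ∃ g₁ g₂ : ℝ × ℝ → ℝ, MemQ w g₁ g₂ ∧
    ∀ φ : ℝ × ℝ → ℝ, IsTestFunction φ →
      ∫ x in upperHalf, (g₁ x * partial₁ φ x + g₂ x * partial₂ φ x)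
        = ∫ x₁ in (-1 : ℝ)..1, -normalDeriv (psi k) (x₁, 0) * φ (x₁, 0)

end MixedProblem

/-!
The solution is explicit. Let `q = z - √(z² - 1)` (`invJ`), with the branch of the root that makes
`q` map the upper half-plane into the unit disc; it inverts the Joukowski map `(q + q⁻¹) / 2`. Expand
`z ^ k = 2⁻ᵏ (q + q⁻¹) ^ k` and let `f` (`potential`) be minus twice the part with positive powers of
`q`. Up to a real constant, `f + z ^ k` is then a real combination of the `q⁻ᵐ - qᵐ`. On
`|x₁| ≥ 1` the number `q` is real, so `w = Im f` vanishes there; on `x₁ = cos θ` it is `exp (-i θ)`,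
and differentiating `2 ^ k cos ^ k θ = ∑ C(k, j) cos ((k - 2 j) θ)` gives the Neumann condition
`∂w/∂x₂ = -k x₁ ^ (k - 1)` (`re_potentialDeriv_neumann`).

The potential is a polynomial in `q` without constant term, so `w` tends to `0` at infinity, and its
energy is at most a multiple of that of `q`, which is the area of `q` of the half-plane
(`lintegral_invJ_deriv_lt_top`). Hence `w` belongs to the completion (`memQ_sol`): a smooth function
of `w` that ignores small values has compact support off the Dirichlet part, and such functions
converge to `w` because `∇w = 0` almost everywhere on `{w = 0}`. The weak equation
(`weak_form_sol`) is the divergence theorem on a rectangle, as test functions vanish near the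
singular points `(±1, 0)`.

For uniqueness (`IsWeakSolution.ae_eq`), the gradient field of the difference of two solutions is
orthogonal to the gradients of the test functions approximating it. By Pythagoras these gradients
tend to `0`, and by a Poincaré inequality (`IsTestFunction.lintegral_sq_le`) so do the test functions
themselves on bounded sets. A weak solution that is continuous up to the Neumann part is therefore
equal to `w` there, and its boundary integral becomes, with `x = cos θ`, an integral of a product of
two sine polynomials. It is evaluated by orthogonality and by the telescoping sum
`∑ (k - 2 j) C(k, j)² = k C(k - 1, ⌊(k - 1) / 2⌋)²`, the sum being over `j < k / 2`
(`integral_neumann`).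
-/

namespace MixedProblem

/-! ### The inverse Joukowski map and the complex potential -/

/-- The branch `i √(-i(z-1)) √(-i(z+1))` of `√(z² - 1)`, holomorphic in the plane slit along the two
vertical rays going down from `1` and `-1`, hence in a neighbourhood of the closed upper half-plane
without these two points. -/
noncomputable def branchSqrt (z : ℂ) : ℂ :=
  Complex.I * (Complex.sqrt (-Complex.I * (z - 1)) * Complex.sqrt (-Complex.I * (z + 1)))

/-- The inverse `z - √(z² - 1)` of the Joukowski map `q ↦ (q + q⁻¹) / 2` which takes the upper
half-plane into the unit disc. -/
noncomputable def invJ (z : ℂ) : ℂ := z - branchSqrt z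

/-- The plane slit along the vertical rays going down from `1` and `-1`. -/
def slitDomain : Set ℂ :=
  {z | -Complex.I * (z - 1) ∈ Complex.slitPlane ∧ -Complex.I * (z + 1) ∈ Complex.slitPlane}

theorem sqrt_mul_self (z : ℂ) : Complex.sqrt z * Complex.sqrt z = z := by
  have := Complex.cpow_nat_inv_pow z (n := 2) two_ne_zero
  rw [← sq]
  exact this

theorem re_sqrt_nonneg (z : ℂ) : 0 ≤ (Complex.sqrt z).re := by
  rw [Complex.sqrt, Complex.cpow_inv_two_re]
  positivity

/-- The principal square roots of numbers with nonnegative real part lie in the sector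
`|arg| ≤ π / 4`. -/
theorem abs_im_sqrt_le {z : ℂ} (hz : 0 ≤ z.re) :
    |(Complex.sqrt z).im| ≤ (Complex.sqrt z).re := by
  rw [← abs_of_nonneg (re_sqrt_nonneg z), ← sq_le_sq]
  have h := congrArg Complex.re (sqrt_mul_self z)
  rw [Complex.mul_re] at h
  nlinarith

theorem abs_im_mul_im_le {z w : ℂ} (hz : 0 ≤ z.re) (hw : 0 ≤ w.re) :
    |(Complex.sqrt z).im * (Complex.sqrt w).im| ≤ (Complex.sqrt z).re * (Complex.sqrt w).re := by
  rw [abs_mul]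
  exact mul_le_mul (abs_im_sqrt_le hz) (abs_im_sqrt_le hw) (abs_nonneg _) (re_sqrt_nonneg z)

theorem re_rot_sub (z : ℂ) : (-Complex.I * (z - 1)).re = z.im := by simp

theorem re_rot_add (z : ℂ) : (-Complex.I * (z + 1)).re = z.im := by simp

theorem branchSqrt_sq (z : ℂ) : branchSqrt z ^ 2 = z ^ 2 - 1 := by
  have h1 := sqrt_mul_self (-Complex.I * (z - 1))
  have h2 := sqrt_mul_self (-Complex.I * (z + 1))
  unfold branchSqrt
  calc _ = Complex.I ^ 2 * ((Complex.sqrt (-Complex.I * (z - 1)) *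
        Complex.sqrt (-Complex.I * (z - 1))) * (Complex.sqrt (-Complex.I * (z + 1)) *
        Complex.sqrt (-Complex.I * (z + 1)))) := by ring
    _ = (Complex.I ^ 2) ^ 2 * (z ^ 2 - 1) := by rw [h1, h2]; ring
    _ = _ := by simp

theorem im_branchSqrt_nonneg {z : ℂ} (hz : 0 ≤ z.im) : 0 ≤ (branchSqrt z).im := by
  have h := (abs_le.1 (abs_im_mul_im_le (z := -Complex.I * (z - 1)) (w := -Complex.I * (z + 1))
    (by rwa [re_rot_sub]) (by rwa [re_rot_add]))).2
  unfold branchSqrt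
  rw [Complex.I_mul_im, Complex.mul_re]
  linarith

theorem invJ_mul (z : ℂ) : invJ z * (z + branchSqrt z) = 1 := by
  unfold invJ
  linear_combination - branchSqrt_sq z

theorem invJ_inv (z : ℂ) : (invJ z)⁻¹ = z + branchSqrt z :=
  (eq_inv_of_mul_eq_one_right (invJ_mul z)).symm

theorem invJ_injective : Function.Injective invJ := by
  intro z w h
  have h1 := congrArg (fun x => x⁻¹ + x) h
  simp only [invJ_inv] at h1
  unfold invJ at h1
  linear_combination h1 / 2

/-- In terms of `a = √(-i(z-1))` and `b = √(-i(z+1))` the number `z + √(z² - 1)` is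
`i (a + b)² / 2`, and `a`, `b` lie in a common sector of opening `π / 2`. -/
theorem norm_add_branchSqrt_ge {z : ℂ} (hz : 0 ≤ z.im) :
    ‖z - 1‖ + ‖z + 1‖ ≤ 2 * ‖z + branchSqrt z‖ := by
  have ha := sqrt_mul_self (-Complex.I * (z - 1))
  have hb := sqrt_mul_self (-Complex.I * (z + 1))
  have hab := (abs_le.1 (abs_im_mul_im_le (z := -Complex.I * (z - 1)) (w := -Complex.I * (z + 1))
    (by rwa [re_rot_sub]) (by rwa [re_rot_add]))).1
  unfold branchSqrt
  set a := Complex.sqrt (-Complex.I * (z - 1))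
  set b := Complex.sqrt (-Complex.I * (z + 1))
  have e : z + Complex.I * (a * b) = Complex.I * (a + b) ^ 2 / 2 := by
    linear_combination -(Complex.I / 2) * ha - (Complex.I / 2) * hb + z * Complex.I_sq
  have na : ‖z - 1‖ = ‖a‖ ^ 2 := by
    have := congrArg norm ha
    simp only [norm_mul, norm_neg, Complex.norm_I, one_mul] at this
    rw [← this, sq]
  have nb : ‖z + 1‖ = ‖b‖ ^ 2 := by
    have := congrArg norm hb
    simp only [norm_mul, norm_neg, Complex.norm_I, one_mul] at this
    rw [← this, sq]
  rw [e, na, nb]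
  simp only [norm_mul, norm_div, Complex.norm_I, one_mul, norm_pow, Complex.norm_ofNat]
  rw [Complex.sq_norm, Complex.sq_norm, Complex.sq_norm, Complex.normSq_apply, Complex.normSq_apply,
    Complex.normSq_apply, Complex.add_re, Complex.add_im]
  nlinarith

theorem norm_invJ_mul {z : ℂ} : ‖invJ z‖ * ‖z + branchSqrt z‖ = 1 := by
  rw [← norm_mul, invJ_mul, norm_one]

theorem norm_invJ_le_one {z : ℂ} (hz : 0 ≤ z.im) : ‖invJ z‖ ≤ 1 := by
  have h1 := norm_add_branchSqrt_ge hz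
  have h2 : (2 : ℝ) ≤ ‖z - 1‖ + ‖z + 1‖ := by
    have := norm_sub_le (z + 1) (z - 1)
    rw [show z + 1 - (z - 1) = 2 by ring] at this
    simp at this
    linarith
  have h3 := norm_invJ_mul (z := z)
  nlinarith [norm_nonneg (invJ z)]

theorem norm_invJ_mul_norm_le {z : ℂ} (hz : 0 ≤ z.im) : ‖invJ z‖ * ‖z‖ ≤ 1 := by
  have h1 := norm_add_branchSqrt_ge hz
  have h2 : 2 * ‖z‖ ≤ ‖z - 1‖ + ‖z + 1‖ := by
    have := norm_add_le (z + 1) (z - 1)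
    rw [show z + 1 + (z - 1) = 2 * z by ring] at this
    simp at this
    linarith
  have h3 := norm_invJ_mul (z := z)
  nlinarith [norm_nonneg (invJ z)]

theorem continuousAt_branchSqrt {z : ℂ} (hz : 0 ≤ z.im) : ContinuousAt branchSqrt z := by
  have h1 : ContinuousAt Complex.sqrt (-Complex.I * (z - 1)) :=
    Complex.continuousAt_sqrt (Or.inl (by rwa [re_rot_sub]))
  have h2 : ContinuousAt Complex.sqrt (-Complex.I * (z + 1)) :=
    Complex.continuousAt_sqrt (Or.inl (by rwa [re_rot_add]))
  have h1' : ContinuousAt (fun z : ℂ => Complex.sqrt (-Complex.I * (z - 1))) z :=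
    ContinuousAt.comp (f := fun z : ℂ => -Complex.I * (z - 1)) h1 (by fun_prop)
  have h2' : ContinuousAt (fun z : ℂ => Complex.sqrt (-Complex.I * (z + 1))) z :=
    ContinuousAt.comp (f := fun z : ℂ => -Complex.I * (z + 1)) h2 (by fun_prop)
  exact continuousAt_const.mul (h1'.mul h2')

theorem continuousAt_invJ {z : ℂ} (hz : 0 ≤ z.im) : ContinuousAt invJ z :=
  continuousAt_id.sub (continuousAt_branchSqrt hz)

theorem isOpen_slitDomain : IsOpen slitDomain :=
  (Complex.isOpen_slitPlane.preimage (by fun_prop)).inter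
    (Complex.isOpen_slitPlane.preimage (by fun_prop))

theorem mem_slitDomain {z : ℂ} (hz : 0 ≤ z.im) (h1 : z ≠ 1) (h2 : z ≠ -1) : z ∈ slitDomain := by
  have key : ∀ w : ℂ, 0 ≤ w.re → w ≠ 0 → w ∈ Complex.slitPlane := by
    intro w hw h0
    rw [Complex.mem_slitPlane_iff]
    by_contra! h
    exact h0 (Complex.ext (le_antisymm h.1 hw) h.2)
  refine ⟨key _ (by rwa [re_rot_sub]) ?_, key _ (by rwa [re_rot_add]) ?_⟩
  · exact mul_ne_zero (by simp) (sub_ne_zero.2 h1)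
  · exact mul_ne_zero (by simp) (fun h => h2 (eq_neg_of_add_eq_zero_left h))

theorem branchSqrt_ne_zero {z : ℂ} (hz : z ∈ slitDomain) : branchSqrt z ≠ 0 := by
  intro h
  have h1 := branchSqrt_sq z
  rw [h] at h1
  have h2 : (z - 1) * (z + 1) = 0 := by linear_combination -h1
  rcases mul_eq_zero.1 h2 with h | h
  · exact Complex.slitPlane_ne_zero hz.1 (by rw [h, mul_zero])
  · exact Complex.slitPlane_ne_zero hz.2 (by rw [h, mul_zero])

theorem differentiableAt_branchSqrt {z : ℂ} (hz : z ∈ slitDomain) :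
    DifferentiableAt ℂ branchSqrt z := by
  have h1' : DifferentiableAt ℂ (fun z : ℂ => Complex.sqrt (-Complex.I * (z - 1))) z :=
    DifferentiableAt.comp (f := fun z : ℂ => -Complex.I * (z - 1)) z
      (Complex.differentiableAt_sqrt hz.1) (by fun_prop)
  have h2' : DifferentiableAt ℂ (fun z : ℂ => Complex.sqrt (-Complex.I * (z + 1))) z :=
    DifferentiableAt.comp (f := fun z : ℂ => -Complex.I * (z + 1)) z
      (Complex.differentiableAt_sqrt hz.2) (by fun_prop)
  exact (differentiableAt_const _).mul (h1'.mul h2')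

theorem hasDerivAt_branchSqrt {z : ℂ} (hz : z ∈ slitDomain) :
    HasDerivAt branchSqrt (z / branchSqrt z) z := by
  have h := (differentiableAt_branchSqrt hz).hasDerivAt
  have h1 : HasDerivAt (fun z => branchSqrt z ^ 2) _ z := h.pow 2
  have h2 : HasDerivAt (fun z => branchSqrt z ^ 2) (2 * z) z := by
    have : (fun z => branchSqrt z ^ 2) = fun z : ℂ => z ^ 2 - 1 := funext branchSqrt_sq
    rw [this]
    simpa using (hasDerivAt_pow 2 z).sub_const 1
  have h3 := h1.unique h2
  have h4 : deriv branchSqrt z = z / branchSqrt z := by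
    rw [eq_div_iff (branchSqrt_ne_zero hz)]
    norm_num at h3
    linear_combination h3 / 2
  rwa [h4] at h

theorem hasDerivAt_invJ {z : ℂ} (hz : z ∈ slitDomain) :
    HasDerivAt invJ (-invJ z / branchSqrt z) z := by
  have h := (hasDerivAt_id z).sub (hasDerivAt_branchSqrt hz)
  have e : 1 - z / branchSqrt z = -invJ z / branchSqrt z := by
    have := branchSqrt_ne_zero hz
    unfold invJ
    field_simp
    ring
  rw [e] at h
  exact h

/-- The holomorphic function whose imaginary part solves the mixed problem: minus twice the part of
`z ^ k = 2⁻ᵏ (q + q⁻¹) ^ k` with positive powers of `q = invJ z`. The range of summation is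
`j < k / 2`, so the subtraction in the exponents does not truncate. -/
noncomputable def potential (k : ℕ) (z : ℂ) : ℂ :=
  -(2 ^ (k - 1) : ℂ)⁻¹ *
    ∑ j ∈ Finset.range ((k + 1) / 2), (k.choose j : ℂ) * invJ z ^ (k - 2 * j)

/-- The complex derivative of `potential k` on `slitDomain`. -/
noncomputable def potentialDeriv (k : ℕ) (z : ℂ) : ℂ :=
  (2 ^ (k - 1) : ℂ)⁻¹ * (∑ j ∈ Finset.range ((k + 1) / 2),
    (k.choose j : ℂ) * ((k - 2 * j : ℕ) * invJ z ^ (k - 2 * j))) / branchSqrt z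

theorem hasDerivAt_potential (k : ℕ) {z : ℂ} (hz : z ∈ slitDomain) :
    HasDerivAt (potential k) (potentialDeriv k z) z := by
  have h1 : ∀ j ∈ Finset.range ((k + 1) / 2),
      HasDerivAt (fun z => (k.choose j : ℂ) * invJ z ^ (k - 2 * j))
        ((k.choose j : ℂ) * ((k - 2 * j : ℕ) * invJ z ^ (k - 2 * j - 1) *
          (-invJ z / branchSqrt z))) z := fun j _ =>
    ((hasDerivAt_invJ hz).pow (k - 2 * j)).const_mul _
  have h2 := (HasDerivAt.fun_sum h1).const_mul (-(2 ^ (k - 1) : ℂ)⁻¹)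
  refine h2.congr_deriv ?_
  unfold potentialDeriv
  rw [mul_div_assoc, Finset.sum_div, neg_mul, ← mul_neg, ← Finset.sum_neg_distrib]
  congr 1
  refine Finset.sum_congr rfl fun j hj => ?_
  have hj' : k - 2 * j = (k - 2 * j - 1) + 1 := by
    have := Finset.mem_range.1 hj
    omega
  have : invJ z ^ (k - 2 * j) = invJ z ^ (k - 2 * j - 1) * invJ z := by
    rw [← pow_succ, ← hj']
  rw [this]
  ring

theorem differentiableOn_potential (k : ℕ) : DifferentiableOn ℂ (potential k) slitDomain :=
  fun _ hz => (hasDerivAt_potential k hz).differentiableAt.differentiableWithinAt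

theorem differentiableOn_potentialDeriv (k : ℕ) :
    DifferentiableOn ℂ (potentialDeriv k) slitDomain := by
  have h := (differentiableOn_potential k).deriv isOpen_slitDomain
  exact h.congr fun z hz => (hasDerivAt_potential k hz).deriv.symm

theorem continuousAt_potential (k : ℕ) {z : ℂ} (hz : 0 ≤ z.im) :
    ContinuousAt (potential k) z := by
  have := continuousAt_invJ hz
  unfold potential
  fun_prop

/-- All exponents in `potential` are positive, so it decays like `invJ`. -/
theorem exists_norm_potential_le (k : ℕ) :
    ∃ C : ℝ, 0 ≤ C ∧ ∀ z : ℂ, 0 ≤ z.im → ‖potential k z‖ ≤ C * ‖invJ z‖ := by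
  refine ⟨‖(2 ^ (k - 1) : ℂ)⁻¹‖ * ∑ j ∈ Finset.range ((k + 1) / 2), (k.choose j : ℝ),
    by positivity, fun z hz => ?_⟩
  unfold potential
  rw [norm_mul, norm_neg, mul_assoc, Finset.sum_mul]
  refine mul_le_mul_of_nonneg_left ?_ (norm_nonneg _)
  refine (norm_sum_le _ _).trans (Finset.sum_le_sum fun j hj => ?_)
  rw [norm_mul, norm_pow, Complex.norm_natCast]
  refine mul_le_mul_of_nonneg_left ?_ (by positivity)
  refine pow_le_of_le_one (norm_nonneg _) (norm_invJ_le_one hz) ?_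
  have := Finset.mem_range.1 hj
  omega

/-- Since `invJ` is bounded by `1`, the derivative of a polynomial in `invJ` is bounded by a multiple
of the derivative of `invJ`. -/
theorem exists_norm_potentialDeriv_le (k : ℕ) :
    ∃ C : ℝ, 0 ≤ C ∧ ∀ z : ℂ, 0 ≤ z.im →
      ‖potentialDeriv k z‖ ≤ C * ‖-invJ z / branchSqrt z‖ := by
  refine ⟨‖(2 ^ (k - 1) : ℂ)⁻¹‖ *
    ∑ j ∈ Finset.range ((k + 1) / 2), (k.choose j : ℝ) * (k - 2 * j : ℕ),
    by positivity, fun z hz => ?_⟩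
  unfold potentialDeriv
  rw [norm_div, norm_div, norm_mul, norm_neg, ← mul_div_assoc, mul_assoc, Finset.sum_mul]
  refine div_le_div_of_nonneg_right (mul_le_mul_of_nonneg_left ?_ (norm_nonneg _)) (norm_nonneg _)
  refine (norm_sum_le _ _).trans (Finset.sum_le_sum fun j hj => ?_)
  rw [norm_mul, norm_mul, norm_pow, Complex.norm_natCast, Complex.norm_natCast, mul_assoc]
  refine mul_le_mul_of_nonneg_left (mul_le_mul_of_nonneg_left ?_ (by positivity)) (by positivity)
  refine pow_le_of_le_one (norm_nonneg _) (norm_invJ_le_one hz) ?_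
  have := Finset.mem_range.1 hj
  omega

theorem measurable_branchSqrt : Measurable branchSqrt := by
  unfold branchSqrt Complex.sqrt
  fun_prop

theorem measurable_potentialDeriv (k : ℕ) : Measurable (potentialDeriv k) := by
  have h1 := measurable_branchSqrt
  have h2 : Measurable invJ := measurable_id.sub h1
  unfold potentialDeriv
  fun_prop

/-- The energy integral of the inverse Joukowski map is the area of its image, which lies in the
unit disc. -/
theorem lintegral_invJ_deriv_lt_top :
    ∫⁻ z in {z : ℂ | 0 < z.im}, ‖-invJ z / branchSqrt z‖ₑ ^ 2 < ⊤ := by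
  have hm : MeasurableSet {z : ℂ | 0 < z.im} :=
    measurableSet_lt measurable_const Complex.measurable_im
  have hd : ∀ z ∈ {z : ℂ | 0 < z.im}, HasFDerivWithinAt invJ
      (((ContinuousLinearMap.toSpanSingleton ℂ (-invJ z / branchSqrt z) :
        ℂ →L[ℂ] ℂ)).restrictScalars ℝ)
      {z : ℂ | 0 < z.im} z := by
    intro z hz
    have hz' : 0 < z.im := hz
    refine ((hasDerivAt_invJ (mem_slitDomain hz'.le ?_ ?_)).hasFDerivAt.restrictScalars
      ℝ).hasFDerivWithinAt
    · rintro rfl; simp at hz'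
    · rintro rfl; simp at hz'
  have h := lintegral_abs_det_fderiv_eq_addHaar_image volume hm hd invJ_injective.injOn
  have e : ∀ c : ℂ, ENNReal.ofReal |((ContinuousLinearMap.toSpanSingleton ℂ c :
        ℂ →L[ℂ] ℂ).restrictScalars ℝ).det| = ‖c‖ₑ ^ 2 := by
    intro c
    have : ((ContinuousLinearMap.toSpanSingleton ℂ c :
        ℂ →L[ℂ] ℂ).restrictScalars ℝ).det = ‖c‖ ^ 2 := by
      simp [ContinuousLinearMap.det, LinearMap.det_restrictScalars,
        Algebra.norm_complex_eq, Complex.normSq_eq_norm_sq]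
    rw [this, abs_of_nonneg (by positivity), ENNReal.ofReal_pow (norm_nonneg _), ofReal_norm]
  simp only [e] at h
  rw [h]
  refine (measure_mono ?_).trans_lt
    (measure_closedBall_lt_top (μ := (volume : Measure ℂ)) (x := 0) (r := 1))
  rintro _ ⟨z, hz, rfl⟩
  rw [mem_closedBall_zero_iff]
  exact norm_invJ_le_one (le_of_lt hz)

/-- On the Dirichlet part `√(z² - 1)` is real, so the imaginary part of the potential vanishes. -/
theorem im_potential_dirichlet (k : ℕ) {x : ℝ} (hx : 1 ≤ x ^ 2) : (potential k x).im = 0 := by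
  have hS : (branchSqrt x).im = 0 := by
    have h := branchSqrt_sq x
    have hre := congrArg Complex.re h
    have him := congrArg Complex.im h
    rw [← Complex.ofReal_pow] at hre him
    simp only [sq, Complex.mul_re, Complex.mul_im, Complex.sub_re, Complex.sub_im,
      Complex.ofReal_re, Complex.ofReal_im, Complex.one_re, Complex.one_im] at hre him
    have h0 : (branchSqrt x).re * (branchSqrt x).im = 0 := by linarith
    rcases mul_eq_zero.1 h0 with h0 | h0
    · rw [h0] at hre
      nlinarith
    · exact h0
  obtain ⟨r, hr⟩ : ∃ r : ℝ, invJ x = r := ⟨(invJ x).re, by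
    apply Complex.ext <;> simp [invJ, hS]⟩
  have : potential k x = ((-(2 ^ (k - 1))⁻¹ *
    ∑ j ∈ Finset.range ((k + 1) / 2), (k.choose j : ℝ) * r ^ (k - 2 * j) : ℝ) : ℂ) := by
    unfold potential
    rw [hr]
    push_cast
    rfl
  rw [this, Complex.ofReal_im]

theorem branchSqrt_cos {θ : ℝ} (h0 : 0 ≤ θ) (hπ : θ ≤ Real.pi) :
    branchSqrt (Real.cos θ) = Complex.I * Real.sin θ := by
  have hs := Real.sin_nonneg_of_nonneg_of_le_pi h0 hπ
  have h := branchSqrt_sq (Real.cos θ)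
  have h1 : (branchSqrt (Real.cos θ)) ^ 2 = (Complex.I * Real.sin θ) ^ 2 := by
    rw [h, mul_pow, Complex.I_sq]
    have := Real.sin_sq_add_cos_sq θ
    have : ((Real.sin θ : ℂ)) ^ 2 + (Real.cos θ : ℂ) ^ 2 = 1 := by exact_mod_cast this
    linear_combination this
  rcases sq_eq_sq_iff_eq_or_eq_neg.1 h1 with h2 | h2
  · exact h2
  · -- The opposite sign would give a root with negative imaginary part, unless `sin θ = 0`.
    have h3 := im_branchSqrt_nonneg (z := Real.cos θ) (by simp)
    rw [h2] at h3
    simp only [Complex.neg_im, Complex.I_mul_im, Complex.ofReal_re] at h3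
    have : Real.sin θ = 0 := by linarith
    rw [h2, this]
    simp

theorem invJ_cos_pow {θ : ℝ} (h0 : 0 ≤ θ) (hπ : θ ≤ Real.pi) (m : ℕ) :
    invJ (Real.cos θ) ^ m = Real.cos (m * θ) - Complex.I * Real.sin (m * θ) := by
  unfold invJ
  rw [branchSqrt_cos h0 hπ]
  have h := Complex.cos_add_sin_mul_I_pow m (-θ : ℂ)
  simp only [Complex.cos_neg, Complex.sin_neg, mul_neg] at h
  push_cast
  rw [show Complex.cos θ - Complex.I * Complex.sin θ = Complex.cos θ + -Complex.sin θ * Complex.I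
    by ring, h]
  ring

/-! ### Boundary values on the Neumann part and the value of the integral -/

/-- A symmetric sum over `0, …, k` without middle term is twice the sum over `j < k / 2`. -/
theorem sum_range_fold (k : ℕ) (g : ℕ → ℝ) (hsymm : ∀ j ≤ k, g (k - j) = g j)
    (hmid : ∀ j, 2 * j = k → g j = 0) :
    ∑ j ∈ Finset.range (k + 1), g j = 2 * ∑ j ∈ Finset.range ((k + 1) / 2), g j := by
  set h := (k + 1) / 2 with hh
  have hrefl : ∑ j ∈ Finset.range h, g (k - j) = ∑ j ∈ Finset.Ico (k + 1 - h) (k + 1), g j := by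
    rw [Finset.range_eq_Ico, Finset.sum_Ico_reflect g 0 (show h ≤ k + 1 by omega)]
    simp
  have hs : ∑ j ∈ Finset.range h, g (k - j) = ∑ j ∈ Finset.range h, g j :=
    Finset.sum_congr rfl fun j hj => hsymm j (by have := Finset.mem_range.1 hj; omega)
  have hm : ∑ j ∈ Finset.Ico h (k + 1 - h), g j = 0 :=
    Finset.sum_eq_zero fun j hj => hmid j (by have := Finset.mem_Ico.1 hj; omega)
  rw [Finset.range_eq_Ico, ← Finset.sum_Ico_consecutive g (Nat.zero_le h) (by omega : h ≤ k + 1),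
    ← Finset.sum_Ico_consecutive g (by omega : h ≤ k + 1 - h) (by omega : k + 1 - h ≤ k + 1), hm,
    ← hrefl, hs, ← Finset.range_eq_Ico]
  ring

theorem two_cos_pow (k : ℕ) (θ : ℝ) :
    2 ^ k * Real.cos θ ^ k
      = ∑ j ∈ Finset.range (k + 1), (k.choose j : ℝ) * Real.cos ((k - 2 * j) * θ) := by
  have h : ((2 ^ k * Real.cos θ ^ k : ℝ) : ℂ) = ∑ j ∈ Finset.range (k + 1),
      (k.choose j : ℂ) * Complex.exp ((((2 * j - k) * θ : ℝ) : ℂ) * Complex.I) := by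
    push_cast
    rw [← mul_pow, Complex.two_cos, add_pow]
    refine Finset.sum_congr rfl fun j hj => ?_
    have hj' : j ≤ k := Nat.lt_succ_iff.1 (Finset.mem_range.1 hj)
    rw [← Complex.exp_nat_mul, ← Complex.exp_nat_mul, ← Complex.exp_add, mul_comm, Nat.cast_sub hj']
    congr 2
    ring
  have h2 := congrArg Complex.re h
  rw [Complex.ofReal_re, Complex.re_sum] at h2
  rw [h2]
  refine Finset.sum_congr rfl fun j _ => ?_
  rw [← Complex.ofReal_natCast, Complex.re_ofReal_mul, Complex.exp_ofReal_mul_I_re, ← Real.cos_neg]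
  congr 2
  ring

/-- The derivative of `two_cos_pow`, with the terms for `j` and `k - j` combined. -/
theorem sum_choose_mul_sin (k : ℕ) (θ : ℝ) :
    ∑ j ∈ Finset.range ((k + 1) / 2),
      (k.choose j : ℝ) * ((k - 2 * j : ℕ) * Real.sin ((k - 2 * j : ℕ) * θ))
      = 2 ^ (k - 1) * (k * Real.cos θ ^ (k - 1) * Real.sin θ) := by
  rcases Nat.eq_zero_or_pos k with rfl | hk
  · simp
  have h1 : HasDerivAt (fun θ => 2 ^ k * Real.cos θ ^ k)
      (2 ^ k * (k * Real.cos θ ^ (k - 1) * -Real.sin θ)) θ :=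
    ((Real.hasDerivAt_cos θ).pow k).const_mul _
  have h2 : HasDerivAt (fun θ => 2 ^ k * Real.cos θ ^ k)
      (∑ j ∈ Finset.range (k + 1), (k.choose j : ℝ) *
        (-Real.sin ((k - 2 * j) * θ) * (((k : ℝ) - 2 * j) * 1))) θ := by
    simp only [two_cos_pow]
    exact HasDerivAt.fun_sum fun j _ =>
      (((hasDerivAt_id θ).const_mul ((k : ℝ) - 2 * j)).cos).const_mul _
  have h3 := h1.unique h2
  rw [sum_range_fold] at h3
  · have h4 : ∑ j ∈ Finset.range ((k + 1) / 2), (k.choose j : ℝ) *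
        (-Real.sin ((k - 2 * j) * θ) * (((k : ℝ) - 2 * j) * 1)) =
        -∑ j ∈ Finset.range ((k + 1) / 2),
          (k.choose j : ℝ) * ((k - 2 * j : ℕ) * Real.sin ((k - 2 * j : ℕ) * θ)) := by
      rw [← Finset.sum_neg_distrib]
      refine Finset.sum_congr rfl fun j hj => ?_
      rw [Nat.cast_sub (by have := Finset.mem_range.1 hj; omega)]
      push_cast
      ring
    rw [h4] at h3
    have h5 : (2 : ℝ) ^ k = 2 * 2 ^ (k - 1) := by
      rw [← pow_succ', Nat.sub_add_cancel hk]
    rw [h5] at h3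
    linarith
  · intro j hj
    rw [Nat.choose_symm hj, Nat.cast_sub hj, show ((k : ℝ) - 2 * (k - j)) = -(k - 2 * j) by ring,
      neg_mul (_ - _) θ, Real.sin_neg]
    ring
  · intro j hj
    rw [← hj]
    push_cast
    simp

theorem im_potential_cos (k : ℕ) {θ : ℝ} (h0 : 0 ≤ θ) (hπ : θ ≤ Real.pi) :
    (potential k (Real.cos θ)).im = (2 ^ (k - 1))⁻¹ *
      ∑ j ∈ Finset.range ((k + 1) / 2), (k.choose j : ℝ) * Real.sin ((k - 2 * j : ℕ) * θ) := by
  unfold potential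
  have e : (-(2 ^ (k - 1) : ℂ)⁻¹) = ((-(2 ^ (k - 1))⁻¹ : ℝ) : ℂ) := by push_cast; rfl
  rw [e, Complex.im_ofReal_mul, Complex.im_sum, neg_mul, ← mul_neg, ← Finset.sum_neg_distrib]
  congr 1
  refine Finset.sum_congr rfl fun j _ => ?_
  rw [invJ_cos_pow h0 hπ, ← Complex.ofReal_natCast, Complex.im_ofReal_mul, Complex.sub_im,
    Complex.ofReal_im, Complex.I_mul_im, Complex.ofReal_re]
  ring

theorem re_potentialDeriv_cos (k : ℕ) {θ : ℝ} (h0 : 0 < θ) (hπ : θ < Real.pi) :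
    (potentialDeriv k (Real.cos θ)).re = -(k * Real.cos θ ^ (k - 1)) := by
  have hs := (Real.sin_pos_of_pos_of_lt_pi h0 hπ).ne'
  unfold potentialDeriv
  have e : ((2 ^ (k - 1) : ℂ)⁻¹) = (((2 ^ (k - 1))⁻¹ : ℝ) : ℂ) := by push_cast; rfl
  have e2 : ∀ z : ℂ, (z / (Complex.I * Real.sin θ)).re = z.im / Real.sin θ := by
    intro z
    rw [← div_div, Complex.div_ofReal_re]
    simp
  rw [branchSqrt_cos h0.le hπ.le, e2, e, Complex.im_ofReal_mul, Complex.im_sum]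
  have : ∑ j ∈ Finset.range ((k + 1) / 2),
      ((k.choose j : ℂ) * ((k - 2 * j : ℕ) * invJ (Real.cos θ) ^ (k - 2 * j))).im =
      -(2 ^ (k - 1) * (k * Real.cos θ ^ (k - 1) * Real.sin θ)) := by
    rw [← sum_choose_mul_sin, ← Finset.sum_neg_distrib]
    refine Finset.sum_congr rfl fun j _ => ?_
    rw [invJ_cos_pow h0.le hπ.le, ← Complex.ofReal_natCast, Complex.im_ofReal_mul,
      ← Complex.ofReal_natCast, Complex.im_ofReal_mul, Complex.sub_im, Complex.ofReal_im,
      Complex.I_mul_im, Complex.ofReal_re]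
    ring
  rw [this]
  field_simp

/-- The Neumann condition: on `(-1, 1)` the vertical derivative of the imaginary part of the
potential is `-k x ^ (k - 1)`. -/
theorem re_potentialDeriv_neumann (k : ℕ) {x : ℝ} (h1 : -1 < x) (h2 : x < 1) :
    (potentialDeriv k x).re = -(k * x ^ (k - 1)) := by
  have h := re_potentialDeriv_cos k (Real.arccos_pos.2 h2) (Real.arccos_lt_pi.2 h1)
  rwa [Real.cos_arccos h1.le h2.le] at h

theorem integral_cos_int_mul {c : ℤ} (hc : c ≠ 0) :
    ∫ θ in (0 : ℝ)..Real.pi, Real.cos (c * θ) = 0 := by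
  rw [intervalIntegral.integral_comp_mul_left (fun x => Real.cos x) (by exact_mod_cast hc),
    integral_cos]
  simp [Real.sin_int_mul_pi]

theorem integral_sin_mul_sin (m n : ℕ) (hm : 0 < m) :
    ∫ θ in (0 : ℝ)..Real.pi, Real.sin (m * θ) * Real.sin (n * θ)
      = if m = n then Real.pi / 2 else 0 := by
  have e : ∀ θ : ℝ, Real.sin (m * θ) * Real.sin (n * θ)
      = (Real.cos (((m - n : ℤ) : ℝ) * θ) - Real.cos (((m + n : ℤ) : ℝ) * θ)) / 2 := by
    intro θ
    push_cast
    rw [sub_mul, add_mul, Real.cos_sub, Real.cos_add]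
    ring
  simp only [e]
  rw [intervalIntegral.integral_div, intervalIntegral.integral_sub
    (Continuous.intervalIntegrable (by fun_prop) _ _)
    (Continuous.intervalIntegrable (by fun_prop) _ _),
    integral_cos_int_mul (by omega : (m + n : ℤ) ≠ 0)]
  split_ifs with h
  · simp [h]
  · rw [integral_cos_int_mul (by omega : (m - n : ℤ) ≠ 0)]
    simp

/-- The sum telescopes, since `(n + 1 - 2 j) C(n + 1, j) = (n + 1) (C(n, j) - C(n, j - 1))`. -/
theorem sum_sub_mul_choose_sq (n J : ℕ) :
    ∑ j ∈ Finset.range (J + 1), ((n : ℝ) + 1 - 2 * j) * ((n + 1).choose j : ℝ) ^ 2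
      = (n + 1) * (n.choose J : ℝ) ^ 2 := by
  induction J with
  | zero => simp
  | succ J ih =>
    rw [Finset.sum_range_succ, ih]
    have h1 : ((n : ℝ) + 1) * n.choose J = (n + 1).choose (J + 1) * (J + 1) := by
      exact_mod_cast Nat.add_one_mul_choose_eq n J
    have h2 : ((n + 1).choose (J + 1) : ℝ) = n.choose J + n.choose (J + 1) := by
      exact_mod_cast Nat.choose_succ_succ n J
    push_cast
    have h3 : ((n : ℝ) + 1 - 2 * (J + 1)) * ((n + 1).choose (J + 1) : ℝ)
        = (n + 1) * (n.choose (J + 1) - n.choose J) := by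
      linear_combination ((n : ℝ) + 1) * h2 + 2 * h1
    rw [sq ((n + 1).choose (J + 1) : ℝ), ← mul_assoc, h3, h2]
    ring

theorem continuous_im_potential (k : ℕ) : Continuous fun x : ℝ => (potential k x).im := by
  refine Complex.continuous_im.comp (continuous_iff_continuousAt.2 fun x => ?_)
  exact (continuousAt_potential k (by simp)).comp Complex.continuous_ofReal.continuousAt

/-- After the substitution `x = cos θ` the integrand is a product of two sine polynomials. -/
theorem integral_neumann (k : ℕ) (hk : 1 ≤ k) :
    ∫ x in (-1 : ℝ)..1, -(k * x ^ (k - 1)) * (potential k x).im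
      = -((k : ℝ) * Real.pi / 2 ^ (2 * k - 1)) * ((k - 1).choose ((k - 1) / 2) : ℝ) ^ 2 := by
  have hcont := continuous_im_potential k
  have hsub := intervalIntegral.integral_comp_mul_deriv (a := 0) (b := Real.pi)
    (f := Real.cos) (f' := fun θ => -Real.sin θ)
    (g := fun x : ℝ => -(k * x ^ (k - 1)) * (potential k x).im)
    (fun x _ => Real.hasDerivAt_cos x) (by fun_prop) (by fun_prop)
  rw [Real.cos_zero, Real.cos_pi] at hsub
  rw [intervalIntegral.integral_symm, ← hsub, ← intervalIntegral.integral_neg]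
  set s := Finset.range ((k + 1) / 2) with hs
  have hsmem : ∀ j ∈ s, 0 < k - 2 * j := fun j hj => by
    have := Finset.mem_range.1 hj
    omega
  have e : ∫ θ in (0 : ℝ)..Real.pi, -(((fun x : ℝ => -(k * x ^ (k - 1)) * (potential k x).im) ∘
        Real.cos) θ * -Real.sin θ)
      = ∫ θ in (0 : ℝ)..Real.pi, ∑ i ∈ s, ∑ j ∈ s, -((2 ^ (k - 1))⁻¹ * (2 ^ (k - 1))⁻¹ *
        ((k.choose i : ℝ) * (k - 2 * i : ℕ) * (k.choose j : ℝ))) *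
          (Real.sin ((k - 2 * i : ℕ) * θ) * Real.sin ((k - 2 * j : ℕ) * θ)) := by
    refine intervalIntegral.integral_congr fun θ hθ => ?_
    rw [uIcc_of_le Real.pi_pos.le] at hθ
    simp only [Function.comp]
    rw [im_potential_cos k hθ.1 hθ.2]
    have h1 := sum_choose_mul_sin k θ
    have h2 : (k : ℝ) * Real.cos θ ^ (k - 1) * Real.sin θ = (2 ^ (k - 1))⁻¹ *
        ∑ j ∈ Finset.range ((k + 1) / 2),
          (k.choose j : ℝ) * ((k - 2 * j : ℕ) * Real.sin ((k - 2 * j : ℕ) * θ)) := by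
      rw [h1]
      field_simp
    have h3 : -(-(↑k * Real.cos θ ^ (k - 1)) * ((2 ^ (k - 1))⁻¹ *
        ∑ j ∈ s, (k.choose j : ℝ) * Real.sin ((k - 2 * j : ℕ) * θ)) * -Real.sin θ)
        = -((k : ℝ) * Real.cos θ ^ (k - 1) * Real.sin θ * ((2 ^ (k - 1))⁻¹ *
        ∑ j ∈ s, (k.choose j : ℝ) * Real.sin ((k - 2 * j : ℕ) * θ))) := by ring
    rw [h3, h2, mul_mul_mul_comm, Finset.sum_mul_sum, Finset.mul_sum, ← Finset.sum_neg_distrib]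
    refine Finset.sum_congr rfl fun i _ => ?_
    rw [Finset.mul_sum, ← Finset.sum_neg_distrib]
    refine Finset.sum_congr rfl fun j _ => ?_
    ring
  rw [e, intervalIntegral.integral_finsetSum
    (fun i _ => Continuous.intervalIntegrable (by fun_prop) _ _)]
  have h4 : ∀ i ∈ s, ∫ θ in (0 : ℝ)..Real.pi, ∑ j ∈ s, -((2 ^ (k - 1))⁻¹ * (2 ^ (k - 1))⁻¹ *
        ((k.choose i : ℝ) * (k - 2 * i : ℕ) * (k.choose j : ℝ))) *
          (Real.sin ((k - 2 * i : ℕ) * θ) * Real.sin ((k - 2 * j : ℕ) * θ))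
      = -((2 ^ (k - 1))⁻¹ * (2 ^ (k - 1))⁻¹ * (Real.pi / 2)) *
        (((k - 1 : ℕ) + 1 - 2 * i) * ((k - 1 + 1).choose i : ℝ) ^ 2) := by
    intro i hi
    rw [intervalIntegral.integral_finsetSum
      (fun i _ => Continuous.intervalIntegrable (by fun_prop) _ _)]
    rw [Finset.sum_eq_single i]
    · rw [intervalIntegral.integral_const_mul, integral_sin_mul_sin _ _ (hsmem i hi), if_pos rfl,
        Nat.sub_add_cancel hk, Nat.cast_sub (by have := hsmem i hi; omega), Nat.cast_sub hk]
      push_cast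
      ring
    · intro j hj hij
      rw [intervalIntegral.integral_const_mul, integral_sin_mul_sin _ _ (hsmem i hi), if_neg,
        mul_zero]
      have := hsmem i hi
      have := hsmem j hj
      omega
    · exact fun h => absurd hi h
  rw [Finset.sum_congr rfl h4, ← Finset.mul_sum, hs, show (k + 1) / 2 = (k - 1) / 2 + 1 by omega,
    sum_sub_mul_choose_sq]
  have h5 : (2 : ℝ) ^ (2 * k - 1) = 2 * (2 ^ (k - 1) * 2 ^ (k - 1)) := by
    rw [← pow_add, ← pow_succ']
    congr 1
    omega
  rw [h5, Nat.cast_sub hk]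
  field_simp
  push_cast
  ring

/-! ### The solution in real coordinates and Green's formula -/

/-- The identification of the plane `ℝ × ℝ` with `ℂ`. -/
noncomputable def toC : (ℝ × ℝ) ≃L[ℝ] ℂ := Complex.equivRealProdCLM.symm

theorem toC_apply (x : ℝ × ℝ) : toC x = x.1 + x.2 * Complex.I :=
  Complex.equivRealProdCLM_symm_apply x

@[simp] theorem toC_re (x : ℝ × ℝ) : (toC x).re = x.1 := by simp [toC_apply]

@[simp] theorem toC_im (x : ℝ × ℝ) : (toC x).im = x.2 := by simp [toC_apply]

theorem toC_ofReal (t : ℝ) : toC (t, 0) = t := by simp [toC_apply]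

theorem norm_le_norm_toC (x : ℝ × ℝ) : ‖x‖ ≤ ‖toC x‖ := by
  rw [Prod.norm_def]
  exact max_le (by simpa using Complex.abs_re_le_norm (toC x))
    (by simpa using Complex.abs_im_le_norm (toC x))

/-- The derivative of a holomorphic function read in the plane `ℝ × ℝ`. -/
theorem hasFDerivAt_comp_toC {F : ℂ → ℂ} {F' : ℂ} {x : ℝ × ℝ} (h : HasDerivAt F F' (toC x)) :
    HasFDerivAt (fun y => F (toC y))
      (((ContinuousLinearMap.toSpanSingleton ℂ F' : ℂ →L[ℂ] ℂ).restrictScalars ℝ).comp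
        (toC : (ℝ × ℝ) →L[ℝ] ℂ)) x :=
  (h.hasFDerivAt.restrictScalars ℝ).comp x toC.hasFDerivAt

theorem hasFDerivAt_im_comp_toC {F : ℂ → ℂ} {F' : ℂ} {x : ℝ × ℝ} (h : HasDerivAt F F' (toC x)) :
    HasFDerivAt (fun y => (F (toC y)).im) (Complex.imCLM.comp
      (((ContinuousLinearMap.toSpanSingleton ℂ F' : ℂ →L[ℂ] ℂ).restrictScalars ℝ).comp
        (toC : (ℝ × ℝ) →L[ℝ] ℂ))) x :=
  Complex.imCLM.hasFDerivAt.comp x (hasFDerivAt_comp_toC h)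

theorem hasFDerivAt_re_comp_toC {F : ℂ → ℂ} {F' : ℂ} {x : ℝ × ℝ} (h : HasDerivAt F F' (toC x)) :
    HasFDerivAt (fun y => (F (toC y)).re) (Complex.reCLM.comp
      (((ContinuousLinearMap.toSpanSingleton ℂ F' : ℂ →L[ℂ] ℂ).restrictScalars ℝ).comp
        (toC : (ℝ × ℝ) →L[ℝ] ℂ))) x :=
  Complex.reCLM.hasFDerivAt.comp x (hasFDerivAt_comp_toC h)

theorem fderiv_im_comp_toC {F : ℂ → ℂ} {F' : ℂ} {x : ℝ × ℝ} (h : HasDerivAt F F' (toC x))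
    (v : ℝ × ℝ) : fderiv ℝ (fun y => (F (toC y)).im) x v = (toC v * F').im := by
  rw [(hasFDerivAt_im_comp_toC h).fderiv]
  simp

theorem normalDeriv_psi (k : ℕ) (t : ℝ) : normalDeriv (psi k) (t, 0) = -(k * t ^ (k - 1)) := by
  have h : psi k = fun x => ((fun z : ℂ => z ^ k) (toC x)).im := by
    funext x
    simp [psi, toC_apply]
  unfold normalDeriv
  rw [h, fderiv_im_comp_toC (hasDerivAt_pow k _), toC_ofReal]
  have e : toC (0, -1) * ((k : ℂ) * (t : ℂ) ^ (k - 1)) =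
      ((-(k * t ^ (k - 1)) : ℝ) : ℂ) * Complex.I := by
    rw [toC_apply]
    push_cast
    ring
  rw [e, Complex.im_ofReal_mul, Complex.I_im, mul_one]

/-- The explicit solution of the mixed problem. -/
noncomputable def sol (k : ℕ) (x : ℝ × ℝ) : ℝ := (potential k (toC x)).im

/-- The first component of the gradient of `sol k`. -/
noncomputable def solGrad₁ (k : ℕ) (x : ℝ × ℝ) : ℝ := (potentialDeriv k (toC x)).im

/-- The second component of the gradient of `sol k`. -/
noncomputable def solGrad₂ (k : ℕ) (x : ℝ × ℝ) : ℝ := (potentialDeriv k (toC x)).re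

theorem isOpen_preimage_slitDomain : IsOpen (toC ⁻¹' slitDomain) :=
  isOpen_slitDomain.preimage toC.continuous

theorem mem_preimage_slitDomain {x : ℝ × ℝ} (hx : 0 ≤ x.2) (hd : x ∉ dirichletPart) :
    x ∈ toC ⁻¹' slitDomain := by
  refine mem_slitDomain (by simpa using hx) ?_ ?_
  · intro h
    refine hd ⟨by simpa using congrArg Complex.im h, Or.inl ?_⟩
    simpa using (congrArg Complex.re h).ge
  · intro h
    refine hd ⟨by simpa using congrArg Complex.im h, Or.inr ?_⟩
    simpa using (congrArg Complex.re h).le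

theorem upperHalf_union_neumannPart_subset :
    upperHalf ∪ neumannPart ⊆ toC ⁻¹' slitDomain := by
  rintro x (hx | hx)
  · have hx' : 0 < x.2 := hx
    exact mem_preimage_slitDomain hx'.le fun h => hx'.ne' h.1
  · refine mem_preimage_slitDomain hx.1.ge fun h => ?_
    rcases h.2 with h | h <;> linarith [hx.2.1, hx.2.2]

theorem upperHalf_subset : upperHalf ⊆ toC ⁻¹' slitDomain :=
  subset_union_left.trans upperHalf_union_neumannPart_subset

theorem contDiffOn_sol (k : ℕ) : ContDiffOn ℝ ∞ (sol k) (toC ⁻¹' slitDomain) := by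
  have h : ContDiffOn ℝ ∞ (potential k) slitDomain :=
    ((differentiableOn_potential k).contDiffOn isOpen_slitDomain).restrict_scalars ℝ
  exact Complex.imCLM.contDiff.comp_contDiffOn
    (h.comp toC.contDiff.contDiffOn (fun x hx => hx))

theorem continuousAt_sol (k : ℕ) {x : ℝ × ℝ} (hx : 0 ≤ x.2) : ContinuousAt (sol k) x :=
  Complex.continuous_im.continuousAt.comp
    ((continuousAt_potential k (by simpa using hx)).comp toC.continuous.continuousAt)

theorem hasFDerivAt_sol (k : ℕ) {x : ℝ × ℝ} (hx : x ∈ toC ⁻¹' slitDomain) :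
    HasFDerivAt (sol k) (solGrad₁ k x • ContinuousLinearMap.fst ℝ ℝ ℝ +
      solGrad₂ k x • ContinuousLinearMap.snd ℝ ℝ ℝ) x := by
  have h := hasFDerivAt_im_comp_toC (hasDerivAt_potential k hx)
  refine h.congr_fderiv ?_
  ext <;> simp [toC_apply, solGrad₁, solGrad₂]

theorem continuousOn_potentialDeriv_comp (k : ℕ) :
    ContinuousOn (fun x => potentialDeriv k (toC x)) (toC ⁻¹' slitDomain) :=
  (differentiableOn_potentialDeriv k).continuousOn.comp toC.continuous.continuousOn
    fun _ h => h

theorem measurable_solGrad₁ (k : ℕ) : Measurable (solGrad₁ k) :=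
  Complex.measurable_im.comp ((measurable_potentialDeriv k).comp toC.continuous.measurable)

theorem measurable_solGrad₂ (k : ℕ) : Measurable (solGrad₂ k) :=
  Complex.measurable_re.comp ((measurable_potentialDeriv k).comp toC.continuous.measurable)

/-- A function with singularities at `(±1, 0)` only becomes continuous on the closed half-plane when
multiplied by one that vanishes near the Dirichlet part. -/
theorem continuousAt_mul_of_tsupport {ψ G : ℝ × ℝ → ℝ} (hψ : Continuous ψ)
    (hG : ContinuousOn G (toC ⁻¹' slitDomain))
    (hd : Disjoint (tsupport ψ) dirichletPart) {x : ℝ × ℝ} (hx : 0 ≤ x.2) :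
    ContinuousAt (fun y => G y * ψ y) x := by
  by_cases h : x ∈ dirichletPart
  · have h0 : ψ =ᶠ[𝓝 x] 0 :=
      notMem_tsupport_iff_eventuallyEq.1 fun h' => Set.disjoint_left.1 hd h' h
    have : (fun y => G y * ψ y) =ᶠ[𝓝 x] fun _ => 0 := by
      filter_upwards [h0] with y hy
      rw [hy]
      simp
    exact continuousAt_const.congr this.symm
  · exact (hG.continuousAt (isOpen_preimage_slitDomain.mem_nhds
      (mem_preimage_slitDomain hx h))).mul hψ.continuousAt

theorem IsTestFunction.continuous_partial₁ {φ : ℝ × ℝ → ℝ} (hφ : IsTestFunction φ) :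
    Continuous (partial₁ φ) :=
  (hφ.smooth.continuous_fderiv (by simp)).clm_apply continuous_const

theorem IsTestFunction.continuous_partial₂ {φ : ℝ × ℝ → ℝ} (hφ : IsTestFunction φ) :
    Continuous (partial₂ φ) :=
  (hφ.smooth.continuous_fderiv (by simp)).clm_apply continuous_const

theorem tsupport_partial₁_subset (φ : ℝ × ℝ → ℝ) : tsupport (partial₁ φ) ⊆ tsupport φ :=
  tsupport_fderiv_apply_subset ℝ _

theorem tsupport_partial₂_subset (φ : ℝ × ℝ → ℝ) : tsupport (partial₂ φ) ⊆ tsupport φ :=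
  tsupport_fderiv_apply_subset ℝ _

theorem IsTestFunction.eq_zero_of_mem {φ : ℝ × ℝ → ℝ} (hφ : IsTestFunction φ) {x : ℝ × ℝ}
    (hx : x ∈ dirichletPart) : φ x = 0 :=
  image_eq_zero_of_notMem_tsupport fun h => Set.disjoint_left.1 hφ.disjoint h hx

/-- A test function vanishes outside the interior of some large square. -/
theorem IsTestFunction.exists_tsupport_subset {φ : ℝ × ℝ → ℝ} (hφ : IsTestFunction φ) :
    ∃ R : ℝ, 1 < R ∧ ∀ x ∈ tsupport φ, |x.1| < R ∧ |x.2| < R := by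
  obtain ⟨R, hR, hsub⟩ := hφ.compact.isCompact.isBounded.subset_ball_lt 1 0
  refine ⟨R, hR, fun x hx => ?_⟩
  have := mem_ball_zero_iff.1 (hsub hx)
  rw [Prod.norm_def, max_lt_iff] at this
  exact this

/-- Green's formula for the explicit solution: the test function vanishes near the singular points
`(±1, 0)`, so that the divergence theorem applies to `φ ∇w` on a large rectangle. -/
theorem weak_form_sol (k : ℕ) {φ : ℝ × ℝ → ℝ} (hφ : IsTestFunction φ) :
    ∫ x in upperHalf, (solGrad₁ k x * partial₁ φ x + solGrad₂ k x * partial₂ φ x)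
      = ∫ x₁ in (-1 : ℝ)..1, -normalDeriv (psi k) (x₁, 0) * φ (x₁, 0) := by
  obtain ⟨R, hR, hsupp⟩ := hφ.exists_tsupport_subset
  have hc1 : ContinuousOn (solGrad₁ k) (toC ⁻¹' slitDomain) :=
    Complex.continuous_im.comp_continuousOn (continuousOn_potentialDeriv_comp k)
  have hc2 : ContinuousOn (solGrad₂ k) (toC ⁻¹' slitDomain) :=
    Complex.continuous_re.comp_continuousOn (continuousOn_potentialDeriv_comp k)
  have hdiv : ContinuousOn
      (fun x => solGrad₁ k x * partial₁ φ x + solGrad₂ k x * partial₂ φ x)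
      (Icc ((-R, 0) : ℝ × ℝ) (R, R)) := fun x hx =>
    ((continuousAt_mul_of_tsupport hφ.continuous_partial₁ hc1
      (hφ.disjoint.mono_left (tsupport_partial₁_subset φ)) hx.1.2).add
    (continuousAt_mul_of_tsupport hφ.continuous_partial₂ hc2
      (hφ.disjoint.mono_left (tsupport_partial₂_subset φ)) hx.1.2)).continuousWithinAt
  have hfd : ∀ x ∈ Ioo (-R) R ×ˢ Ioo 0 R, x ∈ toC ⁻¹' slitDomain := fun x hx =>
    upperHalf_subset hx.2.1
  have hgd : ∀ x ∈ Ioo (-R) R ×ˢ Ioo 0 R,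
      HasDerivAt (potentialDeriv k) (deriv (potentialDeriv k) (toC x)) (toC x) := fun x hx =>
    ((differentiableOn_potentialDeriv k).differentiableAt
      (isOpen_slitDomain.mem_nhds (hfd x hx))).hasDerivAt
  have hφd : ∀ x, HasFDerivAt φ (fderiv ℝ φ x) x := fun x =>
    (hφ.smooth.differentiable (by simp) x).hasFDerivAt
  set G' : ℝ × ℝ → ℝ × ℝ →L[ℝ] ℂ := fun x =>
    (((ContinuousLinearMap.toSpanSingleton ℂ (deriv (potentialDeriv k) (toC x)) :
      ℂ →L[ℂ] ℂ).restrictScalars ℝ).comp (toC : (ℝ × ℝ) →L[ℝ] ℂ)) with hG'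
  have hdiveq : ∀ x,
      (solGrad₁ k x • fderiv ℝ φ x + φ x • Complex.imCLM.comp (G' x)) (1, 0) +
      (solGrad₂ k x • fderiv ℝ φ x + φ x • Complex.reCLM.comp (G' x)) (0, 1)
      = solGrad₁ k x * partial₁ φ x + solGrad₂ k x * partial₂ φ x := by
    intro x
    simp [hG', partial₁, partial₂, toC_apply]
    ring
  have key := integral_divergence_prod_Icc_of_hasFDerivAt_of_le
    (fun x => solGrad₁ k x * φ x) (fun x => solGrad₂ k x * φ x)
    (fun x => solGrad₁ k x • fderiv ℝ φ x + φ x • Complex.imCLM.comp (G' x))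
    (fun x => solGrad₂ k x • fderiv ℝ φ x + φ x • Complex.reCLM.comp (G' x))
    (-R, 0) (R, R) ⟨by simp; linarith, by simp; linarith⟩
    (fun x hx => (continuousAt_mul_of_tsupport hφ.smooth.continuous hc1 hφ.disjoint
      hx.1.2).continuousWithinAt)
    (fun x hx => (continuousAt_mul_of_tsupport hφ.smooth.continuous hc2 hφ.disjoint
      hx.1.2).continuousWithinAt)
    (fun x hx => (hasFDerivAt_im_comp_toC (hgd x hx)).mul (hφd x))
    (fun x hx => (hasFDerivAt_re_comp_toC (hgd x hx)).mul (hφd x))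
    (by
      simp only [hdiveq]
      exact hdiv.integrableOn_compact isCompact_Icc)
  simp only [hdiveq] at key
  have hφ0 : ∀ x : ℝ × ℝ, R ≤ |x.1| ∨ R ≤ |x.2| → φ x = 0 := fun x hx =>
    image_eq_zero_of_notMem_tsupport fun h => by
      rcases hx with hx | hx
      · exact absurd (hsupp x h).1 hx.not_gt
      · exact absurd (hsupp x h).2 hx.not_gt
  have hRR : |R| = R := abs_of_pos (by linarith)
  have z1 : ∀ t : ℝ, φ (t, R) = 0 := fun t => hφ0 _ (Or.inr hRR.ge)
  have z2 : ∀ t : ℝ, φ (R, t) = 0 := fun t => hφ0 _ (Or.inl hRR.ge)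
  have z3 : ∀ t : ℝ, φ (-R, t) = 0 := fun t => hφ0 _ (Or.inl (by rw [abs_neg]; exact hRR.ge))
  simp only [z1, z2, z3, mul_zero, intervalIntegral.integral_zero, zero_sub, add_zero,
    sub_zero] at key
  have hpart : ∀ x : ℝ × ℝ, x ∉ tsupport φ →
      solGrad₁ k x * partial₁ φ x + solGrad₂ k x * partial₂ φ x = 0 := by
    intro x hx
    rw [image_eq_zero_of_notMem_tsupport fun h => hx (tsupport_partial₁_subset φ h),
      image_eq_zero_of_notMem_tsupport fun h => hx (tsupport_partial₂_subset φ h)]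
    simp
  -- The closed half-plane contains the rectangle and differs from the open one by a null set.
  have hae : upperHalf =ᵐ[volume] {x : ℝ × ℝ | 0 ≤ x.2} := by
    have hz : volume ((univ : Set ℝ) ×ˢ ({0} : Set ℝ)) = 0 := by
      rw [Measure.volume_eq_prod, Measure.prod_prod]
      simp
    have hz' : ∀ᵐ x : ℝ × ℝ, x ∉ (univ : Set ℝ) ×ˢ ({0} : Set ℝ) :=
      measure_eq_zero_iff_ae_notMem.1 hz
    filter_upwards [hz'] with x hx
    have hx0 : x.2 ≠ 0 := fun h => hx ⟨mem_univ _, h⟩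
    exact propext ⟨fun h => le_of_lt h, fun h => lt_of_le_of_ne h hx0.symm⟩
  rw [setIntegral_congr_set hae, setIntegral_eq_of_subset_of_forall_sdiff_eq_zero
    (measurableSet_le measurable_const measurable_snd)
    (fun x hx => hx.1.2 : Icc ((-R, 0) : ℝ × ℝ) (R, R) ⊆ {x : ℝ × ℝ | 0 ≤ x.2}), key]
  · rw [intervalIntegral.integral_of_le (by linarith), intervalIntegral.integral_of_le (by norm_num),
      ← integral_neg]
    rw [setIntegral_eq_of_subset_of_forall_sdiff_eq_zero measurableSet_Ioc
      (Ioo_subset_Ioc_self.trans (Ioc_subset_Ioc (by linarith) hR.le) :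
        Ioo (-1 : ℝ) 1 ⊆ Ioc (-R) R), ← integral_Ioc_eq_integral_Ioo]
    · rw [integral_Ioc_eq_integral_Ioo, integral_Ioc_eq_integral_Ioo]
      refine setIntegral_congr_fun measurableSet_Ioo fun t ht => ?_
      simp only [normalDeriv_psi]
      have : solGrad₂ k (t, 0) = -(k * t ^ (k - 1)) := by
        unfold solGrad₂
        rw [toC_ofReal, re_potentialDeriv_neumann k ht.1 ht.2]
      rw [this]
      ring
    · rintro t ⟨_, ht⟩
      rw [hφ.eq_zero_of_mem (x := (t, 0)) ⟨rfl, ?_⟩, mul_zero, neg_zero]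
      by_contra! h
      exact ht ⟨h.2, h.1⟩
  · rintro x ⟨hx, hx'⟩
    refine hpart x fun h => hx' ?_
    have h1 := hsupp x h
    rw [abs_lt, abs_lt] at h1
    exact ⟨⟨h1.1.1.le, hx⟩, ⟨h1.1.2.le, h1.2.2.le⟩⟩

theorem measurableSet_upperHalf : MeasurableSet upperHalf :=
  measurableSet_lt measurable_const measurable_snd

theorem isOpen_upperHalf : IsOpen upperHalf := isOpen_lt continuous_const continuous_snd

theorem measurable_sol (k : ℕ) : Measurable (sol k) := by
  have h2 : Measurable invJ := measurable_id.sub measurable_branchSqrt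
  have h : Measurable (potential k) := by
    unfold potential
    fun_prop
  exact Complex.measurable_im.comp (h.comp toC.continuous.measurable)

/-! ### A smooth truncation near zero -/

/-- There is a smooth function which vanishes near `0`, stays at bounded distance from the identity
and has bounded derivative, equal to `1` far from `0`. -/
theorem exists_smooth_truncation : ∃ (h : ℝ → ℝ) (M : ℝ), ContDiff ℝ ∞ h ∧
    (∀ t, |t| ≤ 1 → h t = 0) ∧ (∀ t, |h t - t| ≤ 2) ∧ (∀ t, |deriv h t - 1| ≤ M) ∧
    ∀ t, 2 < |t| → deriv h t = 1 := by
  let χ : ContDiffBump (0 : ℝ) := ⟨1, 2, by norm_num, by norm_num⟩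
  have hχ : ContDiff ℝ ∞ (χ : ℝ → ℝ) := χ.contDiff
  have hg : ContDiff ℝ ∞ (fun t : ℝ => t * χ t) := contDiff_id.mul hχ
  have hgc : HasCompactSupport (fun t : ℝ => t * χ t) :=
    HasCompactSupport.mul_left (f' := (χ : ℝ → ℝ)) χ.hasCompactSupport
  obtain ⟨M, hM⟩ := (hg.continuous_deriv (by simp)).bounded_above_of_compact_support hgc.deriv
  have hd : ∀ t, deriv (fun t : ℝ => t - t * χ t) t = 1 - deriv (fun t : ℝ => t * χ t) t := by
    intro t
    have := (hasDerivAt_id t).sub (hg.differentiable (by simp) t).hasDerivAt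
    exact this.deriv
  refine ⟨fun t => t - t * χ t, M, contDiff_id.sub hg, ?_, ?_, ?_, ?_⟩
  · intro t ht
    have : χ t = 1 := χ.one_of_mem_closedBall (by simpa using ht)
    simp [this]
  · intro t
    have e : t - t * χ t - t = -(t * χ t) := by ring
    rw [e, abs_neg, abs_mul, abs_of_nonneg χ.nonneg]
    by_cases ht : |t| < 2
    · have := χ.le_one (x := t)
      have := χ.nonneg (x := t)
      nlinarith [abs_nonneg t]
    · have : χ t = 0 := χ.zero_of_le_dist (by simpa using not_lt.1 ht)
      rw [this]
      norm_num
  · intro t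
    rw [hd, sub_sub_cancel_left, abs_neg]
    exact hM t
  · intro t ht
    rw [hd]
    have : (fun t : ℝ => t * χ t) =ᶠ[𝓝 t] fun _ => 0 := by
      filter_upwards [(isOpen_lt continuous_const continuous_abs).mem_nhds ht] with s hs
      rw [χ.zero_of_le_dist (by simpa using (le_of_lt hs : (2 : ℝ) ≤ |s|)), mul_zero]
    rw [this.deriv_eq]
    simp

/-! ### The gradient vanishes almost everywhere on the zero set -/

/-- Zeros with nonzero derivative are isolated. -/
theorem countable_simple_zeros (u u' : ℝ → ℝ) :
    {t | u t = 0 ∧ HasDerivAt u (u' t) t ∧ u' t ≠ 0}.Countable := by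
  have : DiscreteTopology {t | u t = 0 ∧ HasDerivAt u (u' t) t ∧ u' t ≠ 0} := by
    rw [discreteTopology_subtype_iff]
    rintro t ⟨_, hd, h0⟩
    have := hd.eventually_ne h0 (c := 0)
    rw [← disjoint_iff, Filter.disjoint_principal_right]
    filter_upwards [this] with s hs hs'
    exact hs hs'.1
  exact countable_of_Lindelof_of_discrete (X := {t | u t = 0 ∧ HasDerivAt u (u' t) t ∧ u' t ≠ 0})

theorem hasDerivAt_sol_fst (k : ℕ) {x : ℝ × ℝ} (hx : x ∈ toC ⁻¹' slitDomain) :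
    HasDerivAt (fun t => sol k (t, x.2)) (solGrad₁ k x) x.1 := by
  have h1 : HasDerivAt (fun t : ℝ => (t, x.2)) (1, 0) x.1 :=
    (hasDerivAt_id x.1).prodMk (hasDerivAt_const x.1 x.2)
  have h2 := (hasFDerivAt_sol k hx).comp_hasDerivAt x.1 h1
  refine HasDerivAt.congr_deriv h2 ?_
  simp

theorem hasDerivAt_sol_snd (k : ℕ) {x : ℝ × ℝ} (hx : x ∈ toC ⁻¹' slitDomain) :
    HasDerivAt (fun t => sol k (x.1, t)) (solGrad₂ k x) x.2 := by
  have h1 : HasDerivAt (fun t : ℝ => (x.1, t)) (0, 1) x.2 :=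
    (hasDerivAt_const x.2 x.1).prodMk (hasDerivAt_id x.2)
  have h2 := (hasFDerivAt_sol k hx).comp_hasDerivAt x.2 h1
  refine HasDerivAt.congr_deriv h2 ?_
  simp

/-- On almost every line parallel to an axis the zeros of `sol k` with nonzero derivative are
isolated, so almost everywhere on its zero set the gradient vanishes. -/
theorem ae_grad_eq_zero (k : ℕ) : ∀ᵐ x ∂(volume.restrict upperHalf),
    sol k x = 0 → solGrad₁ k x = 0 ∧ solGrad₂ k x = 0 := by
  have hm : ∀ {g : ℝ × ℝ → ℝ}, Measurable g →
      MeasurableSet {x | x ∈ upperHalf ∧ sol k x = 0 ∧ g x ≠ 0} := fun hg =>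
    measurableSet_upperHalf.inter (((measurable_sol k) (measurableSet_singleton 0)).inter
      (hg (measurableSet_singleton 0).compl))
  have h1 : volume {x | x ∈ upperHalf ∧ sol k x = 0 ∧ solGrad₁ k x ≠ 0} = 0 := by
    rw [Measure.volume_eq_prod, Measure.prod_apply_symm (hm (measurable_solGrad₁ k)),
      lintegral_eq_zero_of_ae_eq_zero]
    refine Eventually.of_forall fun y => ?_
    refine ((countable_simple_zeros (fun t => sol k (t, y)) (fun t => solGrad₁ k (t, y))).mono
      ?_).measure_zero volume
    rintro t ⟨ht, h0, h⟩
    exact ⟨h0, hasDerivAt_sol_fst k (x := (t, y)) (upperHalf_subset ht), h⟩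
  have h2 : volume {x | x ∈ upperHalf ∧ sol k x = 0 ∧ solGrad₂ k x ≠ 0} = 0 := by
    rw [Measure.volume_eq_prod, Measure.prod_apply (hm (measurable_solGrad₂ k)),
      lintegral_eq_zero_of_ae_eq_zero]
    refine Eventually.of_forall fun y => ?_
    refine ((countable_simple_zeros (fun t => sol k (y, t)) (fun t => solGrad₂ k (y, t))).mono
      ?_).measure_zero volume
    rintro t ⟨ht, h0, h⟩
    exact ⟨h0, hasDerivAt_sol_snd k (x := (y, t)) (upperHalf_subset ht), h⟩
  rw [ae_restrict_iff' measurableSet_upperHalf]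
  filter_upwards [measure_eq_zero_iff_ae_notMem.1 h1, measure_eq_zero_iff_ae_notMem.1 h2]
    with x hx1 hx2 hx h0
  exact ⟨by_contra fun h => hx1 ⟨hx, h0, h⟩, by_contra fun h => hx2 ⟨hx, h0, h⟩⟩

/-! ### Finite energy -/

theorem lintegral_potentialDeriv_lt_top (k : ℕ) :
    ∫⁻ x in upperHalf, ‖potentialDeriv k (toC x)‖ₑ ^ 2 < ⊤ := by
  have hmp : MeasurePreserving (toC : ℝ × ℝ → ℂ) := Complex.volume_preserving_equiv_real_prod.symm
  have hm : MeasurableSet {z : ℂ | 0 < z.im} :=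
    measurableSet_lt measurable_const Complex.measurable_im
  have hpre : upperHalf = toC ⁻¹' {z : ℂ | 0 < z.im} := by
    ext x
    simp [upperHalf]
  have hmeas : Measurable fun z => ‖potentialDeriv k z‖ₑ ^ 2 :=
    (measurable_potentialDeriv k).enorm.pow_const 2
  rw [hpre, (hmp.setLIntegral_comp_preimage hm hmeas)]
  obtain ⟨C, hC0, hC⟩ := exists_norm_potentialDeriv_le k
  calc ∫⁻ z in {z : ℂ | 0 < z.im}, ‖potentialDeriv k z‖ₑ ^ 2
      ≤ ∫⁻ z in {z : ℂ | 0 < z.im}, (ENNReal.ofReal C) ^ 2 * ‖-invJ z / branchSqrt z‖ₑ ^ 2 := by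
        refine setLIntegral_mono' hm fun z hz => ?_
        rw [← mul_pow]
        gcongr
        have := hC z (le_of_lt hz)
        rw [← ofReal_norm, ← ofReal_norm, ← ENNReal.ofReal_mul hC0]
        exact ENNReal.ofReal_le_ofReal this
    _ = (ENNReal.ofReal C) ^ 2 * ∫⁻ z in {z : ℂ | 0 < z.im}, ‖-invJ z / branchSqrt z‖ₑ ^ 2 :=
        lintegral_const_mul' _ _ (by finiteness)
    _ < ⊤ := ENNReal.mul_lt_top (by finiteness) lintegral_invJ_deriv_lt_top

theorem eLpNorm_two_sq {α : Type*} [MeasurableSpace α] (μ : Measure α) (f : α → ℝ) :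
    eLpNorm f 2 μ ^ 2 = ∫⁻ x, ‖f x‖ₑ ^ 2 ∂μ := by
  have := eLpNorm_nnreal_pow_eq_lintegral (μ := μ) (f := f) (p := 2) two_ne_zero
  simpa using this

theorem eLpNorm_solGrad_lt_top (k : ℕ) :
    eLpNorm (solGrad₁ k) 2 (volume.restrict upperHalf) < ⊤ ∧
    eLpNorm (solGrad₂ k) 2 (volume.restrict upperHalf) < ⊤ := by
  have h := lintegral_potentialDeriv_lt_top k
  have key : ∀ f : ℝ × ℝ → ℝ, (∀ x, |f x| ≤ ‖potentialDeriv k (toC x)‖) →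
      eLpNorm f 2 (volume.restrict upperHalf) < ⊤ := by
    intro f hf
    have : eLpNorm f 2 (volume.restrict upperHalf) ^ 2 < ⊤ := by
      rw [eLpNorm_two_sq]
      refine (lintegral_mono fun x => ?_).trans_lt h
      gcongr
      exact enorm_le_iff_norm_le.2 (hf x)
    exact (ENNReal.pow_lt_top_iff.1 this).resolve_right two_ne_zero
  exact ⟨key _ fun x => Complex.abs_im_le_norm _, key _ fun x => Complex.abs_re_le_norm _⟩

/-- Dominated convergence to zero in `L²`. -/
theorem tendsto_eLpNorm_two_zero {α : Type*} [MeasurableSpace α] {μ : Measure α}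
    {F : ℕ → α → ℝ} {G : α → ℝ} (hF : ∀ n, AEStronglyMeasurable (F n) μ)
    (hG : eLpNorm G 2 μ < ⊤) (hFG : ∀ n, ∀ᵐ x ∂μ, ‖F n x‖ₑ ≤ ‖G x‖ₑ)
    (hlim : ∀ᵐ x ∂μ, Tendsto (fun n => F n x) atTop (𝓝 0)) :
    Tendsto (fun n => eLpNorm (F n) 2 μ) atTop (𝓝 0) := by
  have h1 : Tendsto (fun n => ∫⁻ x, ‖F n x‖ₑ ^ 2 ∂μ) atTop (𝓝 (∫⁻ _, 0 ∂μ)) := by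
    refine tendsto_lintegral_of_dominated_convergence' (fun x => ‖G x‖ₑ ^ 2)
      (fun n => (hF n).enorm.pow_const 2) (fun n => ?_) ?_ ?_
    · filter_upwards [hFG n] with x hx
      gcongr
    · rw [← eLpNorm_two_sq]
      exact (ENNReal.pow_lt_top hG).ne
    · filter_upwards [hlim] with x hx
      have := ((ENNReal.continuous_pow 2).tendsto _).comp ((continuous_enorm.tendsto _).comp hx)
      simpa [Function.comp_def] using this
  rw [lintegral_zero] at h1
  have h2 := ((ENNReal.continuous_rpow_const (y := (2 : ℝ)⁻¹)).tendsto _).comp h1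
  have e : ∀ a : ENNReal, (a ^ 2) ^ (2 : ℝ)⁻¹ = a := fun a => by
    rw [← ENNReal.rpow_natCast, ← ENNReal.rpow_mul]
    norm_num
  simpa [Function.comp_def, ← eLpNorm_two_sq, e] using h2

/-! ### The solution lies in the completion -/

theorem isClosed_dirichletPart : IsClosed dirichletPart :=
  (isClosed_eq continuous_snd continuous_const).inter
    ((isClosed_le continuous_const continuous_fst).union
      (isClosed_le continuous_fst continuous_const))

theorem sol_eq_zero_of_mem (k : ℕ) {x : ℝ × ℝ} (hx : x ∈ dirichletPart) : sol k x = 0 := by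
  have : toC x = (x.1 : ℂ) := by simp [toC_apply, hx.1]
  unfold sol
  rw [this]
  refine im_potential_dirichlet k ?_
  rcases hx.2 with h | h <;> nlinarith

/-- The superlevel sets of `|sol k|` in the closed half-plane are compact, because `sol k` is
continuous there and decays at infinity. -/
theorem isCompact_superlevel (k : ℕ) {δ : ℝ} (hδ : 0 < δ) :
    IsCompact {x : ℝ × ℝ | 0 ≤ x.2 ∧ δ ≤ |sol k x|} := by
  obtain ⟨C, hC0, hC⟩ := exists_norm_potential_le k
  refine Metric.isCompact_of_isClosed_isBounded ?_ ?_
  · have hc : ContinuousOn (fun x => |sol k x|) {x : ℝ × ℝ | 0 ≤ x.2} := fun x hx =>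
      (continuousAt_sol k hx).abs.continuousWithinAt
    exact hc.preimage_isClosed_of_isClosed (isClosed_le continuous_const continuous_snd) isClosed_Ici
  · refine (Metric.isBounded_iff_subset_closedBall 0).2 ⟨C / δ, ?_⟩
    rintro x ⟨hx, hx'⟩
    rw [mem_closedBall_zero_iff]
    have him : 0 ≤ (toC x).im := by simpa using hx
    have h1 : |sol k x| ≤ C * ‖invJ (toC x)‖ := (Complex.abs_im_le_norm _).trans (hC _ him)
    have h2 := norm_invJ_mul_norm_le him
    refine (norm_le_norm_toC x).trans ?_
    rw [le_div_iff₀ hδ]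
    calc ‖toC x‖ * δ ≤ ‖toC x‖ * (C * ‖invJ (toC x)‖) := by
          gcongr
          exact hx'.trans h1
      _ = C * (‖invJ (toC x)‖ * ‖toC x‖) := by ring
      _ ≤ C := mul_le_of_le_one_right hC0 h2

/-- A smooth function of `sol k` that ignores the values below `δ` agrees on the half-plane with a
test function: its support in the closed half-plane is compact and does not meet the Dirichlet part,
and a cutoff equal to `1` there extends it to the plane. -/
theorem exists_test_eq_comp_sol (k : ℕ) {δ : ℝ} (hδ : 0 < δ) {h : ℝ → ℝ} (hh : ContDiff ℝ ∞ h)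
    (h0 : ∀ t, |t| < δ → h t = 0) :
    ∃ φ : ℝ × ℝ → ℝ, IsTestFunction φ ∧ ∀ x ∈ upperHalf, φ x = h (sol k x) := by
  set K := {x : ℝ × ℝ | 0 ≤ x.2 ∧ δ ≤ |sol k x|} with hK
  have hKO : K ⊆ toC ⁻¹' slitDomain ∩ dirichletPartᶜ := by
    rintro x ⟨hx, hx'⟩
    have hd : x ∉ dirichletPart := fun hd => by
      rw [sol_eq_zero_of_mem k hd, abs_zero] at hx'
      linarith
    exact ⟨mem_preimage_slitDomain hx hd, hd⟩
  obtain ⟨L, hL, hKL, hLO⟩ := exists_compact_between (isCompact_superlevel k hδ)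
    (isOpen_preimage_slitDomain.inter isClosed_dirichletPart.isOpen_compl) hKO
  obtain ⟨η, hη, -, hηs, hη1⟩ := exists_contMDiff_support_eq_eq_one_iff
    (n := (⊤ : ℕ∞)) (modelWithCornersSelf ℝ (ℝ × ℝ)) isOpen_interior
    (isCompact_superlevel k hδ).isClosed hKL
  have hη' : ContDiff ℝ ∞ η := contMDiff_iff_contDiff.1 hη
  have hts : tsupport η ⊆ L := by
    rw [tsupport, hηs]
    exact closure_minimal interior_subset hL.isClosed
  have htsφ : tsupport (fun x => η x * h (sol k x)) ⊆ L :=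
    (tsupport_mul_subset_left (f := η) (g := fun x => h (sol k x))).trans hts
  refine ⟨fun x => η x * h (sol k x), ⟨?_, ?_, ?_⟩, fun x hx => ?_⟩
  · refine contDiff_iff_contDiffAt.2 fun x => ?_
    by_cases hx : x ∈ L
    · exact hη'.contDiffAt.mul (hh.contDiffAt.comp x ((contDiffOn_sol k).contDiffAt
        (isOpen_preimage_slitDomain.mem_nhds (hLO hx).1)))
    · have : (fun x => η x * h (sol k x)) =ᶠ[𝓝 x] fun _ => 0 :=
        notMem_tsupport_iff_eventuallyEq.1 fun hx' => hx (htsφ hx')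
      exact contDiffAt_const.congr_of_eventuallyEq this
  · exact hL.of_isClosed_subset (isClosed_tsupport _) htsφ
  · exact (disjoint_compl_left (a := dirichletPart)).mono_left (htsφ.trans fun x hx => (hLO hx).2)
  · by_cases hxK : x ∈ K
    · show η x * h (sol k x) = h (sol k x)
      rw [(hη1 x).1 hxK, one_mul]
    · have hx' : |sol k x| < δ := by
        by_contra! hcon
        exact hxK ⟨le_of_lt hx, hcon⟩
      simp [h0 _ hx']

theorem memQ_sol (k : ℕ) : MemQ (sol k) (solGrad₁ k) (solGrad₂ k) := by
  refine ⟨(measurable_sol k).aestronglyMeasurable, (measurable_solGrad₁ k).aestronglyMeasurable,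
    (measurable_solGrad₂ k).aestronglyMeasurable, ?_⟩
  obtain ⟨h, M, hh, h0, hid, hM, h1⟩ := exists_smooth_truncation
  -- The truncation at height `1 / (n + 1)`.
  set N : ℕ → ℝ := fun n => (n : ℝ) + 1 with hN
  have hNpos : ∀ n, 0 < N n := fun n => by positivity
  set T : ℕ → ℝ → ℝ := fun n t => (N n)⁻¹ * h (N n * t) with hT
  have hTs : ∀ n, ContDiff ℝ ∞ (T n) := fun n =>
    contDiff_const.mul (hh.comp (contDiff_const.mul contDiff_id))
  have hT0 : ∀ n t, |t| < (N n)⁻¹ → T n t = 0 := by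
    intro n t ht
    rw [hT]
    simp only
    rw [h0, mul_zero]
    rw [abs_mul, abs_of_pos (hNpos n)]
    calc N n * |t| ≤ N n * (N n)⁻¹ := by gcongr
      _ = 1 := mul_inv_cancel₀ (hNpos n).ne'
  have hTd : ∀ n t, HasDerivAt (T n) (deriv h (N n * t)) t := by
    intro n t
    have h2 : HasDerivAt (fun t => N n * t) (N n) t := by
      simpa using (hasDerivAt_id t).const_mul (N n)
    have h3 := ((hh.differentiable (by simp) (N n * t)).hasDerivAt.comp t h2).const_mul (N n)⁻¹
    refine HasDerivAt.congr_deriv h3 ?_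
    field_simp [(hNpos n).ne']
  have hTid : ∀ n t, |T n t - t| ≤ 2 * (N n)⁻¹ := by
    intro n t
    have e : T n t - t = (N n)⁻¹ * (h (N n * t) - N n * t) := by
      have := (hNpos n).ne'
      rw [hT]
      field_simp
    rw [e, abs_mul, abs_of_pos (inv_pos.2 (hNpos n)), mul_comm]
    exact mul_le_mul_of_nonneg_right (hid _) (inv_pos.2 (hNpos n)).le
  choose φ hφ hφeq using fun n =>
    exists_test_eq_comp_sol k (inv_pos.2 (hNpos n)) (hTs n) (hT0 n)
  have hgrad : ∀ n, ∀ x ∈ upperHalf, fderiv ℝ (φ n) x = deriv h (N n * sol k x) •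
      (solGrad₁ k x • ContinuousLinearMap.fst ℝ ℝ ℝ +
        solGrad₂ k x • ContinuousLinearMap.snd ℝ ℝ ℝ) := by
    intro n x hx
    have h2 := (hTd n (sol k x)).comp_hasFDerivAt x (hasFDerivAt_sol k (upperHalf_subset hx))
    have h3 : φ n =ᶠ[𝓝 x] T n ∘ sol k := by
      filter_upwards [isOpen_upperHalf.mem_nhds hx] with y hy using hφeq n y hy
    exact (h2.congr_of_eventuallyEq h3).fderiv
  have hp1 : ∀ n, ∀ x ∈ upperHalf, partial₁ (φ n) x - solGrad₁ k x =
      (deriv h (N n * sol k x) - 1) * solGrad₁ k x := by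
    intro n x hx
    rw [partial₁, hgrad n x hx]
    simp
    ring
  have hp2 : ∀ n, ∀ x ∈ upperHalf, partial₂ (φ n) x - solGrad₂ k x =
      (deriv h (N n * sol k x) - 1) * solGrad₂ k x := by
    intro n x hx
    rw [partial₂, hgrad n x hx]
    simp
    ring
  have hMpos : 0 ≤ M := (abs_nonneg _).trans (hM 0)
  have hconv : ∀ (p : ℕ → ℝ × ℝ → ℝ) (g : ℝ × ℝ → ℝ), (∀ n, Continuous (p n)) → Measurable g →
      eLpNorm g 2 (volume.restrict upperHalf) < ⊤ →
      (∀ᵐ x ∂(volume.restrict upperHalf), sol k x = 0 → g x = 0) →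
      (∀ n, ∀ x ∈ upperHalf, p n x - g x = (deriv h (N n * sol k x) - 1) * g x) →
      Tendsto (fun n => eLpNorm (fun x => p n x - g x) 2 (volume.restrict upperHalf))
        atTop (𝓝 0) := by
    intro p g hp hg hgL hg0 hpg
    refine tendsto_eLpNorm_two_zero (G := fun x => M * g x)
      (fun n => ((hp n).measurable.sub hg).aestronglyMeasurable) ?_ (fun n => ?_) ?_
    · have : (fun x => M * g x) = M • g := rfl
      rw [this, eLpNorm_const_smul]
      exact ENNReal.mul_lt_top (by finiteness) hgL
    · filter_upwards [ae_restrict_mem measurableSet_upperHalf] with x hx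
      rw [hpg n x hx, enorm_le_iff_norm_le, norm_mul, norm_mul, Real.norm_eq_abs,
        Real.norm_of_nonneg hMpos]
      gcongr
      exact hM _
    · filter_upwards [ae_restrict_mem measurableSet_upperHalf, hg0] with x hx hx0
      by_cases hs : sol k x = 0
      · refine (tendsto_const_nhds (x := (0 : ℝ))).congr fun n => ?_
        rw [hpg n x hx, hx0 hs, mul_zero]
      · -- For large `n` the truncation is the identity near `sol k x`, up to a constant.
        have hlarge : ∀ᶠ n : ℕ in atTop, 2 < |N n * sol k x| := by
          have hs' : 0 < |sol k x| := abs_pos.2 hs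
          obtain ⟨m, hm⟩ := exists_nat_gt (2 / |sol k x|)
          filter_upwards [eventually_ge_atTop m] with n hn
          rw [abs_mul, abs_of_pos (hNpos n)]
          rw [div_lt_iff₀ hs'] at hm
          have : (m : ℝ) ≤ n := by exact_mod_cast hn
          simp only [hN]
          nlinarith
        refine tendsto_const_nhds.congr' ?_
        filter_upwards [hlarge] with n hn
        rw [hpg n x hx, h1 _ hn]
        ring
  refine ⟨φ, hφ, ?_, ?_, fun R => ?_⟩
  · exact hconv _ _ (fun n => (hφ n).continuous_partial₁) (measurable_solGrad₁ k)
      (eLpNorm_solGrad_lt_top k).1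
      ((ae_grad_eq_zero k).mono fun x hx h => (hx h).1) hp1
  · exact hconv _ _ (fun n => (hφ n).continuous_partial₂) (measurable_solGrad₂ k)
      (eLpNorm_solGrad_lt_top k).2
      ((ae_grad_eq_zero k).mono fun x hx h => (hx h).2) hp2
  · have hfin : volume (upperHalf ∩ Metric.ball 0 R) < ⊤ :=
      (measure_mono inter_subset_right).trans_lt measure_ball_lt_top
    have : IsFiniteMeasure (volume.restrict (upperHalf ∩ Metric.ball (0 : ℝ × ℝ) R)) :=
      ⟨by rwa [Measure.restrict_apply_univ]⟩
    have hb : ∀ n, ∀ x ∈ upperHalf, |φ n x - sol k x| ≤ 2 * (N n)⁻¹ := fun n x hx => by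
      rw [hφeq n x hx]
      exact hTid n _
    refine tendsto_eLpNorm_two_zero (G := fun _ => 2)
      (fun n => ((hφ n).smooth.continuous.measurable.sub (measurable_sol k)).aestronglyMeasurable)
      (memLp_const 2).2 (fun n => ?_) ?_
    · filter_upwards [ae_restrict_mem (measurableSet_upperHalf.inter measurableSet_ball)] with x hx
      rw [enorm_le_iff_norm_le, Real.norm_eq_abs]
      refine (hb n x hx.1).trans ?_
      have : (N n)⁻¹ ≤ 1 := inv_le_one_of_one_le₀ (by simp [hN])
      norm_num
      linarith
    · filter_upwards [ae_restrict_mem (measurableSet_upperHalf.inter measurableSet_ball)] with x hx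
      refine squeeze_zero_norm (fun n => hb n x hx.1) ?_
      have := (tendsto_one_div_add_atTop_nhds_zero_nat (𝕜 := ℝ)).const_mul 2
      simpa [hN] using this

theorem isWeakSolution_sol (k : ℕ) : IsWeakSolution k (sol k) :=
  ⟨solGrad₁ k, solGrad₂ k, memQ_sol k, fun _ hφ => weak_form_sol k hφ⟩

/-! ### Differences of test functions -/

theorem IsTestFunction.sub {φ ψ : ℝ × ℝ → ℝ} (hφ : IsTestFunction φ) (hψ : IsTestFunction ψ) :
    IsTestFunction (φ - ψ) := by
  have h := tsupport_sub φ ψ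
  exact ⟨hφ.smooth.sub hψ.smooth, hφ.compact.sub hψ.compact,
    (hφ.disjoint.union_left hψ.disjoint).mono_left h⟩

theorem IsTestFunction.hasFDerivAt {φ : ℝ × ℝ → ℝ} (hφ : IsTestFunction φ) (x : ℝ × ℝ) :
    HasFDerivAt φ (fderiv ℝ φ x) x := (hφ.smooth.differentiable (by simp) x).hasFDerivAt

theorem IsTestFunction.partial₁_sub {φ ψ : ℝ × ℝ → ℝ} (hφ : IsTestFunction φ)
    (hψ : IsTestFunction ψ) (x : ℝ × ℝ) :
    partial₁ (φ - ψ) x = partial₁ φ x - partial₁ ψ x := by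
  unfold partial₁
  rw [((hφ.hasFDerivAt x).sub (hψ.hasFDerivAt x)).fderiv]
  rfl

theorem IsTestFunction.partial₂_sub {φ ψ : ℝ × ℝ → ℝ} (hφ : IsTestFunction φ)
    (hψ : IsTestFunction ψ) (x : ℝ × ℝ) :
    partial₂ (φ - ψ) x = partial₂ φ x - partial₂ ψ x := by
  unfold partial₂
  rw [((hφ.hasFDerivAt x).sub (hψ.hasFDerivAt x)).fderiv]
  rfl

theorem IsTestFunction.memLp_partial₁ {φ : ℝ × ℝ → ℝ} (hφ : IsTestFunction φ) :
    MemLp (partial₁ φ) 2 (volume.restrict upperHalf) :=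
  (hφ.continuous_partial₁.memLp_of_hasCompactSupport
    (hφ.compact.of_isClosed_subset (isClosed_tsupport _) (tsupport_partial₁_subset φ))).restrict _

theorem IsTestFunction.memLp_partial₂ {φ : ℝ × ℝ → ℝ} (hφ : IsTestFunction φ) :
    MemLp (partial₂ φ) 2 (volume.restrict upperHalf) :=
  (hφ.continuous_partial₂.memLp_of_hasCompactSupport
    (hφ.compact.of_isClosed_subset (isClosed_tsupport _) (tsupport_partial₂_subset φ))).restrict _

/-! ### A Poincaré inequality -/

/-- The Cauchy–Schwarz inequality against the constant `1`. -/
theorem sq_lintegral_enorm_le {μ : Measure ℝ} {f : ℝ → ℝ} (hf : AEStronglyMeasurable f μ) :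
    (∫⁻ t, ‖f t‖ₑ ∂μ) ^ 2 ≤ μ univ * ∫⁻ t, ‖f t‖ₑ ^ 2 ∂μ := by
  have h := eLpNorm_le_eLpNorm_mul_rpow_measure_univ (p := 1) (q := 2) (by norm_num) hf
  rw [eLpNorm_one_eq_lintegral_enorm] at h
  calc (∫⁻ t, ‖f t‖ₑ ∂μ) ^ 2 ≤ _ := pow_le_pow_left' h 2
    _ = _ := by
      rw [mul_pow, eLpNorm_two_sq, mul_comm, ← ENNReal.rpow_natCast (μ univ ^ _),
        ← ENNReal.rpow_mul]
      norm_num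

theorem enorm_sub_sq_le {u u' : ℝ → ℝ} (hu : ∀ t, HasDerivAt u (u' t) t) (hc : Continuous u')
    {a b : ℝ} (hab : a ≤ b) :
    ‖u b - u a‖ₑ ^ 2 ≤ ENNReal.ofReal (b - a) * ∫⁻ t in Ioc a b, ‖u' t‖ₑ ^ 2 := by
  rw [← intervalIntegral.integral_eq_sub_of_hasDerivAt (fun t _ => hu t)
    (hc.intervalIntegrable a b), intervalIntegral.integral_of_le hab]
  refine (pow_le_pow_left' (enorm_integral_le_lintegral_enorm _) 2).trans ?_
  refine (sq_lintegral_enorm_le hc.aestronglyMeasurable).trans ?_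
  rw [Measure.restrict_apply_univ, Real.volume_Ioc]

theorem add_sq_le_two_mul (a b : ENNReal) : (a + b) ^ 2 ≤ 2 * (a ^ 2 + b ^ 2) := by
  have h := ENNReal.rpow_add_le_mul_rpow_add_rpow a b (p := 2) (by norm_num)
  norm_num at h
  exact h

theorem upperHalf_eq_prod : upperHalf = (univ : Set ℝ) ×ˢ Ioi (0 : ℝ) := by
  ext x
  simp [upperHalf]

/-- A point of the square of half-width `R` is joined to the Dirichlet part by a horizontal segment
of length `R + 1` followed by a vertical one. -/
theorem IsTestFunction.enorm_sq_le {φ : ℝ × ℝ → ℝ} (hφ : IsTestFunction φ) {R : ℝ} {x y : ℝ}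
    (hx : |x| < R) (hy : 0 < y) (hyR : y < R) :
    ‖φ (x, y)‖ₑ ^ 2 ≤ 2 * (ENNReal.ofReal (R + 1) * (∫⁻ t, ‖partial₁ φ (t, y)‖ₑ ^ 2) +
      ENNReal.ofReal R * ∫⁻ t in Ioi (0 : ℝ), ‖partial₂ φ (x + (R + 1), t)‖ₑ ^ 2) := by
  have hR : 0 < R := (abs_nonneg x).trans_lt hx
  have h1 : ‖φ (x + (R + 1), y) - φ (x, y)‖ₑ ^ 2 ≤
      ENNReal.ofReal (R + 1) * ∫⁻ t, ‖partial₁ φ (t, y)‖ₑ ^ 2 := by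
    have := enorm_sub_sq_le (u := fun t => φ (t, y)) (u' := fun t => partial₁ φ (t, y))
      (fun t => (hφ.hasFDerivAt (t, y)).comp_hasDerivAt t
        ((hasDerivAt_id t).prodMk (hasDerivAt_const t y)))
      (hφ.continuous_partial₁.comp (by fun_prop)) (a := x) (b := x + (R + 1)) (by linarith)
    refine this.trans ?_
    rw [add_sub_cancel_left]
    gcongr
    exact Measure.restrict_le_self
  have h0 : φ (x + (R + 1), 0) = 0 :=
    hφ.eq_zero_of_mem ⟨rfl, Or.inl (by show 1 ≤ x + (R + 1); linarith [(abs_lt.1 hx).1])⟩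
  have h2 : ‖φ (x + (R + 1), y)‖ₑ ^ 2 ≤
      ENNReal.ofReal R * ∫⁻ t in Ioi (0 : ℝ), ‖partial₂ φ (x + (R + 1), t)‖ₑ ^ 2 := by
    have := enorm_sub_sq_le (u := fun t => φ (x + (R + 1), t))
      (u' := fun t => partial₂ φ (x + (R + 1), t))
      (fun t => (hφ.hasFDerivAt (x + (R + 1), t)).comp_hasDerivAt t
        ((hasDerivAt_const t (x + (R + 1))).prodMk (hasDerivAt_id t)))
      (hφ.continuous_partial₂.comp (by fun_prop)) (a := 0) (b := y) hy.le
    simp only [h0, sub_zero] at this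
    refine this.trans ?_
    gcongr
    exact Ioc_subset_Ioi_self
  have h3 : ‖φ (x, y)‖ₑ ≤ ‖φ (x + (R + 1), y) - φ (x, y)‖ₑ + ‖φ (x + (R + 1), y)‖ₑ := by
    have e : φ (x, y) = φ (x + (R + 1), y) - (φ (x + (R + 1), y) - φ (x, y)) := by ring
    conv_lhs => rw [e]
    exact enorm_sub_le.trans_eq (add_comm _ _)
  refine (pow_le_pow_left' h3 2).trans ((add_sq_le_two_mul _ _).trans ?_)
  gcongr

/-- The gradient norm of a test function controls its `L²` norms on bounded sets. -/
theorem IsTestFunction.lintegral_sq_le {φ : ℝ × ℝ → ℝ} (hφ : IsTestFunction φ) (R : ℝ) :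
    ∫⁻ x in upperHalf ∩ Metric.ball 0 R, ‖φ x‖ₑ ^ 2 ≤
      2 * (ENNReal.ofReal (R + 1) * ENNReal.ofReal (2 * R)) *
        (∫⁻ x in upperHalf, ‖partial₁ φ x‖ₑ ^ 2) +
      2 * (ENNReal.ofReal R * ENNReal.ofReal R) * (∫⁻ x in upperHalf, ‖partial₂ φ x‖ₑ ^ 2) := by
  set A : ℝ → ENNReal := fun y => ∫⁻ t, ‖partial₁ φ (t, y)‖ₑ ^ 2 with hA
  set B : ℝ → ENNReal := fun x => ∫⁻ t in Ioi (0 : ℝ), ‖partial₂ φ (x, t)‖ₑ ^ 2 with hB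
  have hm1 : Measurable fun x => ‖partial₁ φ x‖ₑ ^ 2 :=
    hφ.continuous_partial₁.measurable.enorm.pow_const 2
  have hm2 : Measurable fun x => ‖partial₂ φ x‖ₑ ^ 2 :=
    hφ.continuous_partial₂.measurable.enorm.pow_const 2
  have hAm : Measurable A := Measurable.lintegral_prod_left' hm1
  have hBm : Measurable B := Measurable.lintegral_prod_right' hm2
  have eA : ∫⁻ x in upperHalf, ‖partial₁ φ x‖ₑ ^ 2 = ∫⁻ y in Ioi (0 : ℝ), A y := by
    rw [upperHalf_eq_prod, Measure.volume_eq_prod, ← Measure.prod_restrict, Measure.restrict_univ,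
      lintegral_prod_symm _ hm1.aemeasurable]
  have eB : ∫⁻ x in upperHalf, ‖partial₂ φ x‖ₑ ^ 2 = ∫⁻ x, B x := by
    rw [upperHalf_eq_prod, Measure.volume_eq_prod, ← Measure.prod_restrict, Measure.restrict_univ,
      lintegral_prod _ hm2.aemeasurable]
  have hmF : Measurable fun x : ℝ × ℝ =>
      2 * (ENNReal.ofReal (R + 1) * A x.2 + ENNReal.ofReal R * B (x.1 + (R + 1))) := by fun_prop
  have hsub : upperHalf ∩ Metric.ball 0 R ⊆ Ioo (-R) R ×ˢ Ioo 0 R := by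
    rintro x ⟨hx, hxR⟩
    rw [mem_ball_zero_iff, Prod.norm_def, max_lt_iff] at hxR
    exact ⟨abs_lt.1 hxR.1, hx, (abs_lt.1 hxR.2).2⟩
  calc ∫⁻ x in upperHalf ∩ Metric.ball 0 R, ‖φ x‖ₑ ^ 2
      ≤ ∫⁻ x in Ioo (-R) R ×ˢ Ioo 0 R, ‖φ x‖ₑ ^ 2 := lintegral_mono_set hsub
    _ ≤ ∫⁻ x in Ioo (-R) R ×ˢ Ioo 0 R,
        2 * (ENNReal.ofReal (R + 1) * A x.2 + ENNReal.ofReal R * B (x.1 + (R + 1))) := by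
      refine setLIntegral_mono hmF fun x hx => ?_
      exact hφ.enorm_sq_le (abs_lt.2 hx.1) hx.2.1 hx.2.2
    _ = ∫⁻ x in Ioo (-R) R, ∫⁻ y in Ioo 0 R,
        (2 * ENNReal.ofReal (R + 1) * A y + 2 * ENNReal.ofReal R * B (x + (R + 1))) := by
      rw [Measure.volume_eq_prod, ← Measure.prod_restrict, lintegral_prod _ hmF.aemeasurable]
      refine lintegral_congr fun x => lintegral_congr fun y => ?_
      ring
    _ = 2 * (ENNReal.ofReal (R + 1) * ENNReal.ofReal (2 * R)) * (∫⁻ y in Ioo 0 R, A y) +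
        2 * (ENNReal.ofReal R * ENNReal.ofReal R) * ∫⁻ x in Ioo (-R) R, B (x + (R + 1)) := by
      have hin : ∀ x : ℝ, ∫⁻ y in Ioo 0 R,
          (2 * ENNReal.ofReal (R + 1) * A y + 2 * ENNReal.ofReal R * B (x + (R + 1))) =
          2 * ENNReal.ofReal (R + 1) * (∫⁻ y in Ioo 0 R, A y) +
          2 * (ENNReal.ofReal R * ENNReal.ofReal R) * B (x + (R + 1)) := by
        intro x
        rw [lintegral_add_right _ measurable_const, lintegral_const_mul _ hAm, setLIntegral_const,
          Real.volume_Ioo, sub_zero]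
        ring
      simp only [hin]
      rw [lintegral_add_left measurable_const, setLIntegral_const, Real.volume_Ioo,
        lintegral_const_mul _ (by fun_prop), show R - -R = 2 * R by ring]
      ring
    _ ≤ _ := by
      rw [eA, eB]
      refine add_le_add (mul_le_mul' le_rfl ?_) (mul_le_mul' le_rfl ?_)
      · exact lintegral_mono_set Ioo_subset_Ioi_self
      · refine (setLIntegral_le_lintegral _ _).trans ?_
        rw [lintegral_add_right_eq_self B]

/-! ### Uniqueness -/

theorem lintegral_enorm_sq_eq {α : Type*} [MeasurableSpace α] {μ : Measure α} {f : α → ℝ}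
    (hf : MemLp f 2 μ) : ∫⁻ x, ‖f x‖ₑ ^ 2 ∂μ = ENNReal.ofReal (∫ x, f x ^ 2 ∂μ) := by
  rw [ofReal_integral_eq_lintegral_ofReal hf.integrable_sq (ae_of_all _ fun x => sq_nonneg _)]
  refine lintegral_congr fun x => ?_
  rw [Real.enorm_eq_ofReal_abs, ← ENNReal.ofReal_pow (abs_nonneg _), sq_abs]

/-- Pythagoras: a vector field orthogonal to `(p₁, p₂)` is at distance at least the norm of
`(p₁, p₂)` from it. -/
theorem lintegral_le_of_orthogonal {α : Type*} [MeasurableSpace α] {μ : Measure α}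
    {p₁ p₂ g₁ g₂ : α → ℝ} (hp₁ : MemLp p₁ 2 μ) (hp₂ : MemLp p₂ 2 μ) (hg₁ : MemLp g₁ 2 μ)
    (hg₂ : MemLp g₂ 2 μ) (horth : ∫ x, (g₁ x * p₁ x + g₂ x * p₂ x) ∂μ = 0) :
    (∫⁻ x, ‖p₁ x‖ₑ ^ 2 ∂μ) + ∫⁻ x, ‖p₂ x‖ₑ ^ 2 ∂μ ≤
      (∫⁻ x, ‖p₁ x - g₁ x‖ₑ ^ 2 ∂μ) + ∫⁻ x, ‖p₂ x - g₂ x‖ₑ ^ 2 ∂μ := by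
  have i1 := hp₁.integrable_sq
  have i2 := hp₂.integrable_sq
  have j1 := (hp₁.sub hg₁).integrable_sq
  have j2 := (hp₂.sub hg₂).integrable_sq
  have l1 := hg₁.integrable_sq
  have l2 := hg₂.integrable_sq
  have i12 : Integrable (fun x => p₁ x ^ 2 + p₂ x ^ 2) μ := i1.add i2
  have l12 : Integrable (fun x => g₁ x ^ 2 + g₂ x ^ 2) μ := l1.add l2
  have m1 : Integrable (fun x => g₁ x * p₁ x + g₂ x * p₂ x) μ :=
    (hg₁.integrable_mul hp₁).add (hg₂.integrable_mul hp₂)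
  have n1 : ∀ f : α → ℝ, 0 ≤ ∫ x, f x ^ 2 ∂μ := fun f => integral_nonneg fun x => sq_nonneg _
  rw [lintegral_enorm_sq_eq hp₁, lintegral_enorm_sq_eq hp₂,
    show ∫⁻ x, ‖p₁ x - g₁ x‖ₑ ^ 2 ∂μ = _ from lintegral_enorm_sq_eq (hp₁.sub hg₁),
    show ∫⁻ x, ‖p₂ x - g₂ x‖ₑ ^ 2 ∂μ = _ from lintegral_enorm_sq_eq (hp₂.sub hg₂),
    ← ENNReal.ofReal_add (n1 _) (n1 _), ← ENNReal.ofReal_add (n1 _) (n1 _)]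
  refine ENNReal.ofReal_le_ofReal ?_
  have e : (∫ x, (p₁ - g₁) x ^ 2 ∂μ) + ∫ x, (p₂ - g₂) x ^ 2 ∂μ =
      ((∫ x, p₁ x ^ 2 ∂μ) + ∫ x, p₂ x ^ 2 ∂μ) + ((∫ x, g₁ x ^ 2 ∂μ) + ∫ x, g₂ x ^ 2 ∂μ) := by
    rw [← integral_add j1 j2, ← integral_add i1 i2, ← integral_add l1 l2, ← integral_add i12 l12]
    have : ∀ x, (p₁ - g₁) x ^ 2 + (p₂ - g₂) x ^ 2 =
        (p₁ x ^ 2 + p₂ x ^ 2 + (g₁ x ^ 2 + g₂ x ^ 2)) - 2 * (g₁ x * p₁ x + g₂ x * p₂ x) := by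
      intro x
      simp only [Pi.sub_apply]
      ring
    simp only [this]
    refine (integral_sub (i12.add l12) (m1.const_mul 2)).trans ?_
    rw [integral_const_mul, horth, mul_zero, sub_zero]
    rfl
  show _ ≤ (∫ x, (p₁ - g₁) x ^ 2 ∂μ) + ∫ x, (p₂ - g₂) x ^ 2 ∂μ
  rw [e]
  linarith [n1 g₁, n1 g₂]

/-- The norms in the approximation may be infinite for finitely many `n`. -/
theorem memLp_of_approx {p : ℕ → ℝ × ℝ → ℝ} {g : ℝ × ℝ → ℝ} {μ : Measure (ℝ × ℝ)}
    (hp : ∀ n, MemLp (p n) 2 μ) (hg : AEStronglyMeasurable g μ)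
    (hlim : Tendsto (fun n => eLpNorm (fun x => p n x - g x) 2 μ) atTop (𝓝 0)) :
    MemLp g 2 μ := by
  obtain ⟨n, hn⟩ := (hlim.eventually_lt_const (show (0 : ENNReal) < ⊤ by simp)).exists
  have h : MemLp (fun x => p n x - g x) 2 μ := ⟨(hp n).1.sub hg, hn⟩
  have := (hp n).sub h
  refine this.ae_eq (ae_of_all _ fun x => ?_)
  simp

theorem tendsto_eLpNorm_sub {p q : ℕ → ℝ × ℝ → ℝ} {f g : ℝ × ℝ → ℝ} {μ : Measure (ℝ × ℝ)}
    (hp : ∀ n, AEStronglyMeasurable (p n) μ) (hq : ∀ n, AEStronglyMeasurable (q n) μ)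
    (hf : AEStronglyMeasurable f μ) (hg : AEStronglyMeasurable g μ)
    (h1 : Tendsto (fun n => eLpNorm (fun x => p n x - f x) 2 μ) atTop (𝓝 0))
    (h2 : Tendsto (fun n => eLpNorm (fun x => q n x - g x) 2 μ) atTop (𝓝 0)) :
    Tendsto (fun n => eLpNorm (fun x => (p n x - q n x) - (f x - g x)) 2 μ) atTop (𝓝 0) := by
  have h3 := h1.add h2
  rw [add_zero] at h3
  refine tendsto_of_tendsto_of_tendsto_of_le_of_le tendsto_const_nhds h3 (fun n => zero_le)
    fun n => ?_
  have e : (fun x => (p n x - q n x) - (f x - g x)) =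
      (fun x => p n x - f x) - fun x => q n x - g x := by
    funext x
    simp only [Pi.sub_apply]
    ring
  show eLpNorm (fun x => (p n x - q n x) - (f x - g x)) 2 μ ≤ _
  rw [e]
  exact eLpNorm_sub_le ((hp n).sub hf) ((hq n).sub hg) (by norm_num)

theorem IsWeakSolution.ae_eq {k : ℕ} {w w' : ℝ × ℝ → ℝ} (hw : IsWeakSolution k w)
    (hw' : IsWeakSolution k w') : w =ᵐ[volume.restrict upperHalf] w' := by
  obtain ⟨g₁, g₂, ⟨mw, m1, m2, φ, hφ, c1, c2, c0⟩, weak⟩ := hw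
  obtain ⟨g₁', g₂', ⟨mw', m1', m2', φ', hφ', c1', c2', c0'⟩, weak'⟩ := hw'
  set μ := volume.restrict upperHalf with hμ
  have L1 := memLp_of_approx (fun n => (hφ n).memLp_partial₁) m1 c1
  have L2 := memLp_of_approx (fun n => (hφ n).memLp_partial₂) m2 c2
  have L1' := memLp_of_approx (fun n => (hφ' n).memLp_partial₁) m1' c1'
  have L2' := memLp_of_approx (fun n => (hφ' n).memLp_partial₂) m2' c2'
  set ψ : ℕ → ℝ × ℝ → ℝ := fun n => φ n - φ' n with hψdef
  have hψ : ∀ n, IsTestFunction (ψ n) := fun n => (hφ n).sub (hφ' n)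
  have d1 : Tendsto (fun n => eLpNorm (fun x => partial₁ (ψ n) x - (g₁ x - g₁' x)) 2 μ)
      atTop (𝓝 0) := by
    simp only [hψdef, fun n x => (hφ n).partial₁_sub (hφ' n) x]
    exact tendsto_eLpNorm_sub (fun n => (hφ n).memLp_partial₁.1) (fun n => (hφ' n).memLp_partial₁.1)
      m1 m1' c1 c1'
  have d2 : Tendsto (fun n => eLpNorm (fun x => partial₂ (ψ n) x - (g₂ x - g₂' x)) 2 μ)
      atTop (𝓝 0) := by
    simp only [hψdef, fun n x => (hφ n).partial₂_sub (hφ' n) x]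
    exact tendsto_eLpNorm_sub (fun n => (hφ n).memLp_partial₂.1) (fun n => (hφ' n).memLp_partial₂.1)
      m2 m2' c2 c2'
  have horth : ∀ n, ∫ x, ((g₁ - g₁') x * partial₁ (ψ n) x + (g₂ - g₂') x * partial₂ (ψ n) x) ∂μ
      = 0 := by
    intro n
    have h1 := weak _ (hψ n)
    rw [← weak' _ (hψ n), ← sub_eq_zero, ← integral_sub] at h1
    · rw [← h1]
      refine integral_congr_ae (ae_of_all _ fun x => ?_)
      simp only [Pi.sub_apply]
      ring
    · exact (L1.integrable_mul (hψ n).memLp_partial₁).add (L2.integrable_mul (hψ n).memLp_partial₂)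
    · exact (L1'.integrable_mul (hψ n).memLp_partial₁).add
        (L2'.integrable_mul (hψ n).memLp_partial₂)
  -- Hence `‖∇ψ n‖ ≤ ‖∇ψ n - (g - g')‖`, which tends to `0`.
  have hle := fun n => lintegral_le_of_orthogonal (hψ n).memLp_partial₁ (hψ n).memLp_partial₂
    (L1.sub L1') (L2.sub L2') (horth n)
  have hsq : ∀ {a : ℕ → ENNReal}, Tendsto a atTop (𝓝 0) →
      Tendsto (fun n => a n ^ 2) atTop (𝓝 0) := fun h => by
    simpa [Function.comp_def] using ((ENNReal.continuous_pow 2).tendsto _).comp h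
  have hgrad : Tendsto (fun n => (∫⁻ x, ‖partial₁ (ψ n) x‖ₑ ^ 2 ∂μ) +
      ∫⁻ x, ‖partial₂ (ψ n) x‖ₑ ^ 2 ∂μ) atTop (𝓝 0) := by
    have h3 := (hsq d1).add (hsq d2)
    simp only [eLpNorm_two_sq, add_zero] at h3
    exact tendsto_of_tendsto_of_tendsto_of_le_of_le tendsto_const_nhds h3 (fun n => zero_le) hle
  have hψ0 : ∀ R : ℝ, Tendsto (fun n => ∫⁻ x in upperHalf ∩ Metric.ball 0 R, ‖ψ n x‖ₑ ^ 2)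
      atTop (𝓝 0) := by
    intro R
    set C : ENNReal := 2 * (ENNReal.ofReal (R + 1) * ENNReal.ofReal (2 * R)) +
      2 * (ENNReal.ofReal R * ENNReal.ofReal R) with hC
    have hCtop : C ≠ ⊤ := by rw [hC]; finiteness
    have h4 := ENNReal.Tendsto.const_mul hgrad (Or.inr hCtop)
    rw [mul_zero] at h4
    refine tendsto_of_tendsto_of_tendsto_of_le_of_le tendsto_const_nhds h4 (fun n => zero_le)
      fun n => ((hψ n).lintegral_sq_le R).trans ?_
    rw [mul_add]
    gcongr
    · exact le_self_add
    · exact le_add_self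
  have hball : ∀ R : ℝ, w =ᵐ[volume.restrict (upperHalf ∩ Metric.ball 0 R)] w' := by
    intro R
    set ν := volume.restrict (upperHalf ∩ Metric.ball (0 : ℝ × ℝ) R) with hν
    have hνμ : ν ≤ μ := Measure.restrict_mono inter_subset_left le_rfl
    have mψ : ∀ n, AEStronglyMeasurable (ψ n) ν := fun n =>
      (hψ n).smooth.continuous.aestronglyMeasurable
    have md : AEStronglyMeasurable (fun x => w x - w' x) ν :=
      (mw.mono_measure hνμ).sub (mw'.mono_measure hνμ)
    have h5 : Tendsto (fun n => eLpNorm (fun x => ψ n x - (w x - w' x)) 2 ν) atTop (𝓝 0) :=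
      tendsto_eLpNorm_sub (fun n => (hφ n).smooth.continuous.aestronglyMeasurable)
        (fun n => (hφ' n).smooth.continuous.aestronglyMeasurable) (mw.mono_measure hνμ)
        (mw'.mono_measure hνμ) (c0 R) (c0' R)
    have h6 : Tendsto (fun n => 2 * (∫⁻ x, ‖ψ n x‖ₑ ^ 2 ∂ν +
        ∫⁻ x, ‖ψ n x - (w x - w' x)‖ₑ ^ 2 ∂ν)) atTop (𝓝 0) := by
      have h7 := (hψ0 R).add (hsq h5)
      simp only [eLpNorm_two_sq, add_zero] at h7
      simpa using ENNReal.Tendsto.const_mul h7 (Or.inr (by simp : (2 : ENNReal) ≠ ⊤))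
    have h8 : ∫⁻ x, ‖w x - w' x‖ₑ ^ 2 ∂ν = 0 := by
      refine le_antisymm (ge_of_tendsto' h6 fun n => ?_) (zero_le)
      rw [← lintegral_add_left' ((mψ n).enorm.pow_const 2),
        ← lintegral_const_mul' _ _ (by simp)]
      refine lintegral_mono fun x => ?_
      refine le_trans ?_ (add_sq_le_two_mul _ _)
      gcongr
      have e : w x - w' x = ψ n x - (ψ n x - (w x - w' x)) := by ring
      conv_lhs => rw [e]
      exact enorm_sub_le
    rw [lintegral_eq_zero_iff' (md.enorm.pow_const 2)] at h8
    filter_upwards [h8] with x hx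
    simpa [sub_eq_zero] using hx
  have hU : upperHalf = ⋃ n : ℕ, upperHalf ∩ Metric.ball (0 : ℝ × ℝ) n := by
    rw [← inter_iUnion, Metric.iUnion_ball_nat, inter_univ]
  rw [hμ, hU]
  exact (ae_restrict_iUnion_iff _ _).2 fun n => hball n

/-! ### Solutions that are regular up to the Neumann part -/

theorem IsWeakSolution.eqOn_sol {k : ℕ} {w : ℝ × ℝ → ℝ} (hw : IsWeakSolution k w)
    (hc : ContinuousOn w (upperHalf ∪ neumannPart)) :
    EqOn w (sol k) (upperHalf ∪ neumannPart) := by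
  have hs : ContinuousOn (sol k) (upperHalf ∪ neumannPart) :=
    (contDiffOn_sol k).continuousOn.mono upperHalf_union_neumannPart_subset
  have h := Measure.eqOn_open_of_ae_eq (hw.ae_eq (isWeakSolution_sol k)) isOpen_upperHalf
    (hc.mono subset_union_left) (hs.mono subset_union_left)
  refine h.of_subset_closure hc hs subset_union_left (union_subset subset_closure ?_)
  rintro x ⟨hx, -⟩
  rw [upperHalf_eq_prod, closure_prod_eq, closure_Ioi]
  exact ⟨by simp, hx.ge⟩

/-- The boundary integrand of a solution that is continuous up to the Neumann part. -/
theorem IsWeakSolution.integrand_eq {k : ℕ} {w : ℝ × ℝ → ℝ} (hw : IsWeakSolution k w)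
    (hc : ContinuousOn w (upperHalf ∪ neumannPart)) {x : ℝ} (h1 : -1 < x) (h2 : x < 1) :
    derivWithin (fun y : ℝ => w (x, y)) (Ici 0) 0 * w (x, 0)
      = -(k * x ^ (k - 1)) * (potential k x).im := by
  have hE := hw.eqOn_sol hc
  have hmem : (x, (0 : ℝ)) ∈ upperHalf ∪ neumannPart := Or.inr ⟨rfl, h1, h2⟩
  have hEq : EqOn (fun y : ℝ => w (x, y)) (fun y => sol k (x, y)) (Ici 0) := fun y hy =>
    hE ((eq_or_lt_of_le (mem_Ici.1 hy)).elim (fun h => by rwa [← h]) fun h => Or.inl h)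
  have hd : HasDerivAt (fun y => sol k (x, y)) (solGrad₂ k (x, 0)) 0 :=
    hasDerivAt_sol_snd k (x := (x, 0)) (upperHalf_union_neumannPart_subset hmem)
  rw [derivWithin_congr hEq (hEq self_mem_Ici),
    hd.hasDerivWithinAt.derivWithin (uniqueDiffOn_Ici 0 0 self_mem_Ici), hE hmem, solGrad₂, sol,
    toC_ofReal, re_potentialDeriv_neumann k h1 h2]

end MixedProblem

/-- The mixed problem has a weak solution `w_k` that is `C¹` up to the Neumann part, any two weak
solutions agree almost everywhere in the half-plane, and for the (any) representative of `w_k`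
that is `C¹` up to the Neumann part the integral of `∂w_k/∂x₂ * w_k` over that part has the stated
value. -/
theorem proposition3p2 (k : ℕ) (hk : 1 ≤ k) :
    (∃ w : ℝ × ℝ → ℝ, MixedProblem.IsWeakSolution k w ∧
      ContDiffOn ℝ 1 w (MixedProblem.upperHalf ∪ MixedProblem.neumannPart)) ∧
    (∀ w w' : ℝ × ℝ → ℝ, MixedProblem.IsWeakSolution k w → MixedProblem.IsWeakSolution k w' →
      w =ᵐ[volume.restrict MixedProblem.upperHalf] w') ∧
    (∀ w : ℝ × ℝ → ℝ, MixedProblem.IsWeakSolution k w →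
      ContDiffOn ℝ 1 w (MixedProblem.upperHalf ∪ MixedProblem.neumannPart) →
      IntervalIntegrable
        (fun x₁ : ℝ => derivWithin (fun x₂ : ℝ => w (x₁, x₂)) (Set.Ici 0) 0 * w (x₁, 0))
        volume (-1) 1 ∧
      ∫ x₁ in (-1 : ℝ)..1, derivWithin (fun x₂ : ℝ => w (x₁, x₂)) (Set.Ici 0) 0 * w (x₁, 0)
        = -((k : ℝ) * Real.pi / 2 ^ (2 * k - 1)) * ((k - 1).choose ((k - 1) / 2) : ℝ) ^ 2) := by
  refine ⟨⟨MixedProblem.sol k, MixedProblem.isWeakSolution_sol k,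
    ((MixedProblem.contDiffOn_sol k).of_le (by simp)).mono
      MixedProblem.upperHalf_union_neumannPart_subset⟩,
    fun w w' hw hw' => hw.ae_eq hw', fun w hw hc => ?_⟩
  have h : EqOn (fun x : ℝ => -(k * x ^ (k - 1)) * (MixedProblem.potential k x).im)
      (fun x₁ : ℝ => derivWithin (fun x₂ : ℝ => w (x₁, x₂)) (Set.Ici 0) 0 * w (x₁, 0))
      (uIoo (-1) 1) := fun x hx => by
    rw [uIoo_of_le (by norm_num)] at hx
    exact (hw.integrand_eq hc.continuousOn hx.1 hx.2).symm
  have hcont := MixedProblem.continuous_im_potential k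
  refine ⟨IntervalIntegrable.congr_uIoo
    (Continuous.intervalIntegrable (by fun_prop) (-1) 1 : IntervalIntegrable
      (fun x : ℝ => -(k * x ^ (k - 1)) * (MixedProblem.potential k x).im) volume (-1) 1) h, ?_⟩
  rw [← intervalIntegral.integral_congr_uIoo h, MixedProblem.integral_neumann k hk]
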